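/- Let $\Bbbk$ be an algebraically closed field and let $A$ be a finite-dimensional $\Bbbk$-algebra with a chosen finite complete set of orthogonal primitive idempotents $\{e_\lambda\}_{\lambda\in\Lambda}$, $\sum_{\lambda\in\Lambda} e_\lambda=1$. Put $P_\lambda=Ae_\lambda$ and $S_\lambda=P_\lambda/\operatorname{rad}P_\lambda$, and assume that $A$ is basic, i.e. $P_\lambda\not\cong P_\mu$ for $\lambda\neq\mu$. For a linear order $\preccurlyeq$ on $\Lambda$, let the standard module $\Delta_\lambda$ be the largest quotient of $P_\lambda$ all of whose composition factors $S_\mu$ satisfy $\mu\preccurlyeq\lambda$, and let the proper standard module $\overline{\Delta}_\lambda$ be the largest quotient of $P_\lambda$ all of whose composition factors $S_\mu$ satisfy $\mu\prec\lambda$, except for one copy of $S_\lambda$. The algebra $A$ is properly stratified with respect to $\preccurlyeq$ if the left regular module ${}_AA$ has a finite filtration all of whose factors are isomorphic to modules $\Delta_\lambda$, and also a finite filtration all of whose factors are isomorphic to modules $\overline{\Delta}_\lambda$. The associated category $\mathcal{A}$ of $A$ has objects $e_\lambda$ ($\lambda\in\Lambda$), morphism spaces $\mathcal{A}(e_\lambda,e_\mu)=e_\mu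 Ae_\lambda$, and composition given by multiplication in $A$. It is directed if there is a partial order $\leqslant$ on $\Lambda$ such that $\mathcal{A}(e_\lambda,e_\mu)\neq 0$ implies $\lambda\leqslant\mu$. In that case $J=\bigoplus_{\lambda\neq\mu\in\Lambda}e_\mu Ae_\lambda$ is a two-sided ideal of $A$. Then $A$ is properly stratified with respect to every linear order on $\Lambda$ if and only if $\mathcal{A}$ is directed and $J$ is projective both as a left and as a right $A$-module. -/

import Mathlib

namespace StratAlg

open CategoryTheory

universe u v w

section Modules

variable (A : Type v) [Ring A]

/-- A primitive idempotent: a nonzero idempotent which is not the sum of two nonzero orthogonal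
idempotents. -/
def IsPrimitiveIdempotent {A : Type v} [Ring A] (e : A) : Prop :=
  IsIdempotentElem e ∧ e ≠ 0 ∧
    ∀ f g : A, IsIdempotentElem f → IsIdempotentElem g → f * g = 0 → g * f = 0 →
      f + g = e → f = 0 ∨ g = 0

/-- `[M : S] = n`: the module `M` has a composition series from `0` to `M` exactly `n` of whose
factors are isomorphic to `S`. (For `M` of finite length, such an `n` exists and is unique by the
Jordan–Hölder theorem.) -/
def HasMultiplicity (M : Type*) [AddCommGroup M] [Module A M]
    (S : Type*) [AddCommGroup S] [Module A S] (n : ℕ) : Prop :=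
  ∃ s : CompositionSeries (Submodule A M), s.head = ⊥ ∧ s.last = ⊤ ∧
    Set.ncard {i : Fin s.length |
      Nonempty ((↥(s i.succ) ⧸ (s i.castSucc).submoduleOf (s i.succ)) ≃ₗ[A] S)} = n

/-- `M` belongs to `F(X)`: it has a finite filtration by submodules, from `0` to `M`, each of whose
factors is isomorphic to some `X i`. -/
def HasFiltrationBy (M : Type*) [AddCommGroup M] [Module A M]
    {ι : Type*} (X : ι → Type*) [∀ i, AddCommGroup (X i)] [∀ i, Module A (X i)] : Prop :=
  ∃ (n : ℕ) (F : Fin (n + 1) → Submodule A M), Monotone F ∧ F 0 = ⊥ ∧ F (Fin.last n) = ⊤ ∧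
    ∀ j : Fin n, ∃ i : ι,
      Nonempty ((↥(F j.succ) ⧸ (F j.castSucc).submoduleOf (F j.succ)) ≃ₗ[A] X i)

end Modules

section Stratification

variable {A : Type v} [Ring A] {Λ : Type w} (e : Λ → A)

/-- The left module `P_l = A e_l`. -/
abbrev ProjMod (l : Λ) : Submodule A A := Submodule.span A {e l}

/-- The module `S_l = P_l / rad P_l`. -/
abbrev SimpleMod (l : Λ) : Type v := ↥(ProjMod e l) ⧸ Module.jacobson A ↥(ProjMod e l)

/-- `A` is basic, in terms of a complete set of orthogonal primitive idempotents: the modules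
`P_l` are pairwise nonisomorphic. -/
def IsBasic : Prop :=
  ∀ l m : Λ, l ≠ m → IsEmpty (↥(ProjMod e l) ≃ₗ[A] ↥(ProjMod e m))

variable [LinearOrder Λ]

/-- The least submodule `N` of `P_l` such that every composition factor `S_m` of `P_l / N`
satisfies `m ≤ l`. -/
def standardKer (l : Λ) : Submodule A ↥(ProjMod e l) :=
  sInf {N | ∀ m : Λ, ¬ m ≤ l → HasMultiplicity A (↥(ProjMod e l) ⧸ N) (SimpleMod e m) 0}

/-- The standard module: the largest quotient of `P_l` all of whose composition
factors `S_m` satisfy `m ≤ l`. -/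
abbrev StandardMod (l : Λ) : Type v := ↥(ProjMod e l) ⧸ standardKer e l

/-- The least submodule `N` of `P_l` such that every composition factor `S_m` of `P_l / N`
satisfies `m < l`, except for one copy of `S_l`. -/
def properStandardKer (l : Λ) : Submodule A ↥(ProjMod e l) :=
  sInf {N | HasMultiplicity A (↥(ProjMod e l) ⧸ N) (SimpleMod e l) 1 ∧
    ∀ m : Λ, m ≠ l → ¬ m < l → HasMultiplicity A (↥(ProjMod e l) ⧸ N) (SimpleMod e m) 0}

/-- The proper standard module: the largest quotient of `P_l` all of whose composition
factors `S_m` satisfy `m < l`, except for one copy of `S_l`. -/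
abbrev ProperStandardMod (l : Λ) : Type v := ↥(ProjMod e l) ⧸ properStandardKer e l

/-- `A` is properly stratified with respect to the given linear order on `Λ`: the left regular
module has a filtration by standard modules and a filtration by proper standard modules. -/
def IsProperlyStratified : Prop :=
  HasFiltrationBy A A (StandardMod e) ∧ HasFiltrationBy A A (ProperStandardMod e)

end Stratification

/-- A category with zero morphisms is directed if there is a partial order on its
objects such that `X ≤ Y` whenever there is a nonzero morphism from `X` to `Y`. -/
def IsDirectedCategory (C : Type*) [Category C] [Limits.HasZeroMorphisms C] : Prop :=
  ∃ r : C → C → Prop, IsPartialOrder C r ∧ ∀ (X Y : C) (f : X ⟶ Y), f ≠ 0 → r X Y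

section AssociatedCategory

variable (k : Type u) [Field k] {A : Type v} [Ring A] [Algebra k A] {Λ : Type w} [Fintype Λ]

/-- The subspace `e_m A e_l` of `A`. -/
def peirce (e : Λ → A) (l m : Λ) : Submodule k A :=
  LinearMap.range (LinearMap.mulLeft k (e m) ∘ₗ LinearMap.mulRight k (e l))

theorem mem_peirce {e : Λ → A} {l m : Λ} {x : A} :
    x ∈ peirce k e l m ↔ ∃ a : A, e m * (a * e l) = x := by
  simp [peirce, LinearMap.mem_range]

/-- The objects of the associated category: one object for each idempotent `e_l`. -/
@[ext]
structure AssocCat (k : Type u) [Field k] {A : Type v} [Ring A] [Algebra k A] {Λ : Type w}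
    [Fintype Λ] {e : Λ → A} (he : CompleteOrthogonalIdempotents e) where
  /-- The index of the object. -/
  idx : Λ

variable {e : Λ → A} (he : CompleteOrthogonalIdempotents e)

theorem e_mul_of_mem {l m : Λ} {x : A} (he : CompleteOrthogonalIdempotents e)
    (hx : x ∈ peirce k e l m) : e m * x = x := by
  obtain ⟨a, rfl⟩ := (mem_peirce k).1 hx
  rw [← mul_assoc, (he.idem m).eq]

theorem mul_e_of_mem {l m : Λ} {x : A} (he : CompleteOrthogonalIdempotents e)
    (hx : x ∈ peirce k e l m) : x * e l = x := by
  obtain ⟨a, rfl⟩ := (mem_peirce k).1 hx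
  rw [mul_assoc, mul_assoc, (he.idem l).eq]

theorem mul_mem_peirce {l m n : Λ} {x y : A} (hx : x ∈ peirce k e l m)
    (hy : y ∈ peirce k e m n) : y * x ∈ peirce k e l n := by
  obtain ⟨a, rfl⟩ := (mem_peirce k).1 hx
  obtain ⟨b, rfl⟩ := (mem_peirce k).1 hy
  exact (mem_peirce k).2 ⟨b * e m * (e m * a), by simp only [mul_assoc]⟩

theorem e_mem_peirce (he : CompleteOrthogonalIdempotents e) (l : Λ) : e l ∈ peirce k e l l :=
  (mem_peirce k).2 ⟨1, by rw [one_mul, (he.idem l).eq]⟩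

/-- The associated category of `A`: morphisms from `e_l` to `e_m` are the elements of `e_m A e_l`,
and composition is multiplication in `A`, from right to left. -/
instance : Category (AssocCat k he) where
  Hom X Y := ↥(peirce k e X.idx Y.idx)
  id X := ⟨e X.idx, e_mem_peirce k he X.idx⟩
  comp f g := ⟨(g : A) * (f : A), mul_mem_peirce (e := e) k f.2 g.2⟩
  id_comp f := Subtype.ext (mul_e_of_mem (e := e) k he f.2)
  comp_id f := Subtype.ext (e_mul_of_mem (e := e) k he f.2)
  assoc _ _ _ := Subtype.ext (mul_assoc _ _ _).symm

instance : Preadditive (AssocCat k he) where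
  homGroup X Y := inferInstanceAs (AddCommGroup ↥(peirce k e X.idx Y.idx))
  add_comp _ _ _ _ _ _ := Subtype.ext (mul_add _ _ _)
  comp_add _ _ _ _ _ _ := Subtype.ext (add_mul _ _ _)

instance : Linear k (AssocCat k he) where
  homModule X Y := inferInstanceAs (Module k ↥(peirce k e X.idx Y.idx))
  smul_comp _ _ _ _ _ _ := Subtype.ext (mul_smul_comm _ _ _)
  comp_smul _ _ _ _ _ _ := Subtype.ext (smul_mul_assoc _ _ _)

/-- The subspace `J = ⨁_{l ≠ m} e_m A e_l` of `A`. -/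
def offDiag (e : Λ → A) : Submodule k A :=
  ⨆ (l : Λ) (m : Λ) (_ : l ≠ m), peirce k e l m

variable {k} {he}

theorem peirce_le_offDiag {l m : Λ} (h : l ≠ m) : peirce k e l m ≤ offDiag k e :=
  le_iSup_of_le l (le_iSup_of_le m (le_iSup_of_le h le_rfl))

theorem offDiag_le {p : Submodule k A} (h : ∀ l m : Λ, l ≠ m → peirce k e l m ≤ p) :
    offDiag k e ≤ p :=
  iSup_le fun l => iSup_le fun m => iSup_le fun hlm => h l m hlm

theorem mul_eq_zero_of_isDirected (hd : IsDirectedCategory (AssocCat k he)) {l m : Λ} (h : l ≠ m)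
    {x y : A} (hx : x ∈ peirce k e l m) (hy : y ∈ peirce k e m l) : y * x = 0 := by
  obtain ⟨r, hr, H⟩ := hd
  by_contra hne
  have hx0 : x ≠ 0 := by rintro rfl; simp at hne
  have hy0 : y ≠ 0 := by rintro rfl; simp at hne
  have h1 := H ⟨l⟩ ⟨m⟩ ⟨x, hx⟩ (fun h0 => hx0 (congrArg Subtype.val h0))
  have h2 := H ⟨m⟩ ⟨l⟩ ⟨y, hy⟩ (fun h0 => hy0 (congrArg Subtype.val h0))
  exact h (congrArg AssocCat.idx (hr.antisymm _ _ h1 h2))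

theorem mul_mem_offDiag_left (hd : IsDirectedCategory (AssocCat k he)) (a : A) {x : A}
    (hx : x ∈ offDiag k e) : a * x ∈ offDiag k e := by
  suffices H : offDiag k e ≤ (offDiag k e).comap (LinearMap.mulLeft k a) from H hx
  refine offDiag_le fun l m hlm y hy => ?_
  have hy' : a * y = ∑ n, e n * (a * e m) * y := by
    rw [← Finset.sum_mul, ← Finset.sum_mul, he.complete, one_mul, mul_assoc,
      e_mul_of_mem k he hy]
  rw [Submodule.mem_comap, LinearMap.mulLeft_apply, hy']
  refine Submodule.sum_mem _ fun n _ => ?_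
  have hz : e n * (a * e m) ∈ peirce k e m n := (mem_peirce k).2 ⟨a, rfl⟩
  by_cases hn : l = n
  · subst hn
    rw [mul_eq_zero_of_isDirected hd hlm hy hz]
    exact Submodule.zero_mem _
  · exact peirce_le_offDiag hn (mul_mem_peirce k hy hz)

theorem mul_mem_offDiag_right (hd : IsDirectedCategory (AssocCat k he)) (a : A) {x : A}
    (hx : x ∈ offDiag k e) : x * a ∈ offDiag k e := by
  suffices H : offDiag k e ≤ (offDiag k e).comap (LinearMap.mulRight k a) from H hx
  refine offDiag_le fun l m hlm y hy => ?_
  have hy' : y * a = ∑ n, y * (e l * (a * e n)) := by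
    rw [← Finset.mul_sum, ← Finset.mul_sum, ← Finset.mul_sum, he.complete, mul_one, ← mul_assoc,
      mul_e_of_mem k he hy]
  rw [Submodule.mem_comap, LinearMap.mulRight_apply, hy']
  refine Submodule.sum_mem _ fun n _ => ?_
  have hz : e l * (a * e n) ∈ peirce k e n l := (mem_peirce k).2 ⟨a, rfl⟩
  by_cases hn : n = m
  · subst hn
    rw [mul_eq_zero_of_isDirected hd (Ne.symm hlm) hz hy]
    exact Submodule.zero_mem _
  · exact peirce_le_offDiag hn (mul_mem_peirce k hz hy)

/-- `J` as a left `A`-module, when the associated category is directed. -/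
def leftJ (hd : IsDirectedCategory (AssocCat k he)) : Submodule A A where
  carrier := offDiag k e
  add_mem' := (offDiag k e).add_mem
  zero_mem' := (offDiag k e).zero_mem
  smul_mem' a _ hx := mul_mem_offDiag_left hd a hx

/-- `J` as a right `A`-module (a left module over the opposite ring), when the associated category
is directed. -/
def rightJ (hd : IsDirectedCategory (AssocCat k he)) : Submodule Aᵐᵒᵖ A where
  carrier := offDiag k e
  add_mem' := (offDiag k e).add_mem
  zero_mem' := (offDiag k e).zero_mem
  smul_mem' a _ hx := mul_mem_offDiag_right hd a.unop hx

end AssociatedCategory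

end StratAlg

/-!
Write `S M` (in the code `S • ⊤`) for the submodule of `M` generated by all `s x` with `s ∈ S` and
`x ∈ M`; for `S = {e_t | t ∈ T}` it is the trace in `M` of the modules `P_t`, `t ∈ T`. Then
`Δ_l = P_l / S P_l` for `S = {e_t | l < t}`, and enlarging `S` by the nilpotent elements of
`e_l A e_l` gives the proper standard module.

Suppose that `A` is properly stratified for every order. If `m` is maximal then `Δ_m = P_m`, and the
trace of `P_m` in `A` is projective; hence `e_m A e_l ≠ 0` forces `P_m ↪ P_l`. By dimensions the
relation `P_m ↪ P_l` between `l` and `m` is a partial order, so the category is directed. Let `ν` be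
minimal. If the other elements are ordered against this relation, then `P_t = Δ_t` for `t ≠ ν`, and
the trace `J e_ν` of these modules in `P_ν` is projective. If they are ordered along it, then the
proper standard filtration computes `dim e_ν J`, and the result is the dimension of the projective
cover of the right module `e_ν J`.

Conversely, if `J` is projective, then so is each `J e_l ⊆ P_l`. Splitting off copies of `P_l` from
projective modules and descending from `P_l` to `J e_l`, one filters all traces in `A` by standard
modules. The same induction for the opposite algebra gives
`dim Δ_l = dim (e_l A e_l) * dim (proper standard module at l)`. In general `≤` holds here: socle
vectors of the `e_l A e_l`-module `e_l Δ_l` generate quotients of the proper standard module, which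
are factored out one after the other. Equality means that each of them is the whole proper standard
module.
-/

namespace StratAlg

open CategoryTheory MulOpposite Submodule
open scoped Pointwise

universe u

section SetSMul

variable {A M M' : Type*} [Ring A] [AddCommGroup M] [Module A M] [AddCommGroup M'] [Module A M']

theorem set_smul_le_self (S : Set A) (N : Submodule A M) : S • N ≤ N :=
  set_smul_le S N N fun a _ _ hx => N.smul_mem a hx

theorem map_set_smul (S : Set A) (N : Submodule A M) (φ : M →ₗ[A] M') :
    (S • N).map φ = S • N.map φ := by
  refine le_antisymm (map_le_iff_le_comap.2 (set_smul_le S N _ fun a x ha hx => ?_))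
    (set_smul_le S _ _ ?_)
  · rw [mem_comap, map_smul]
    exact mem_set_smul_of_mem_mem ha (mem_map_of_mem hx)
  · rintro a _ ha ⟨x, hx, rfl⟩
    rw [← map_smul]
    exact mem_map_of_mem (mem_set_smul_of_mem_mem ha hx)

theorem map_mem_set_smul_top {S : Set A} (φ : M →ₗ[A] M') {x : M}
    (hx : x ∈ S • (⊤ : Submodule A M)) : φ x ∈ S • (⊤ : Submodule A M') :=
  (smul_mono_right S le_top : S • (⊤ : Submodule A M).map φ ≤ _)
    (map_set_smul S ⊤ φ ▸ mem_map_of_mem hx)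

theorem map_subtype_set_smul_top (S : Set A) (N : Submodule A M) :
    (S • (⊤ : Submodule A ↥N)).map N.subtype = S • N := by
  rw [map_set_smul, map_subtype_top]

/-- For a submodule `N`, the submodule `S N` does not depend on whether it is formed inside `N` or
inside the ambient module. -/
noncomputable def setSMulTopEquiv (S : Set A) (N : Submodule A M) :
    ↥(S • (⊤ : Submodule A ↥N)) ≃ₗ[A] ↥(S • N) :=
  (equivMapOfInjective N.subtype N.injective_subtype _).trans
    (LinearEquiv.ofEq _ _ (map_subtype_set_smul_top S N))

theorem set_smul_set_smul_of_isIdempotentElem {S : Set A} (hS : ∀ s ∈ S, IsIdempotentElem s)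
    (N : Submodule A M) : S • (S • N) = S • N :=
  le_antisymm (set_smul_le_self S _) (set_smul_le S N _ fun s x hs hx => by
    rw [← (hS s hs).eq, mul_smul]
    exact mem_set_smul_of_mem_mem hs (mem_set_smul_of_mem_mem hs hx))

/-- The sum of the `a s N` with `a : A` and `s ∈ S` is a submodule, so it is all of `S N`. -/
theorem smul_mem_of_mem_set_smul {S : Set A} {N : Submodule A M} {V : AddSubgroup M} {f : A}
    (h : ∀ a : A, ∀ s ∈ S, ∀ n ∈ N, f • a • s • n ∈ V) {x : M} (hx : x ∈ S • N) : f • x ∈ V := by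
  let L : Submodule A M :=
    { carrier := {y | ∀ a : A, f • a • y ∈ V}
      add_mem' := fun hy hz a => by
        rw [smul_add, smul_add]
        exact V.add_mem (hy a) (hz a)
      zero_mem' := fun a => by
        rw [smul_zero, smul_zero]
        exact V.zero_mem
      smul_mem' := fun b y hy a => by
        rw [← mul_smul a b y]
        exact hy (a * b) }
  have hL : S • N ≤ L := set_smul_le S N L fun s n hs hn a => h a s hs n hn
  rw [← one_smul A x]
  exact hL hx 1

end SetSMul

section Principal

variable {A M : Type*} [Ring A] [AddCommGroup M] [Module A M] {f : A}

/-- The homomorphism `A f → M` given by `a ↦ a x`. When `f` is idempotent, every homomorphism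
`A f → M` is of this form for a unique `x` with `f x = x`. -/
def evalAt (f : A) (x : M) : ↥(span A {f}) →ₗ[A] M :=
  LinearMap.toSpanSingleton A M x ∘ₗ (span A {f}).subtype

@[simp]
theorem evalAt_apply (f : A) (x : M) (p : ↥(span A {f})) : evalAt f x p = (p : A) • x := rfl

/-- The element `f` of the principal left ideal `A f`, as a generator. -/
def gen (f : A) : ↥(span A {f}) := ⟨f, mem_span_singleton_self f⟩

theorem evalAt_ne_zero {x : M} (hx : f • x ≠ 0) : evalAt f x ≠ 0 :=
  fun h => hx (LinearMap.congr_fun h (gen f))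

theorem mem_span_idem (hf : IsIdempotentElem f) {x : A} : x ∈ span A {f} ↔ x * f = x := by
  refine mem_span_singleton.trans ⟨?_, fun h => ⟨x, h⟩⟩
  rintro ⟨a, rfl⟩
  rw [smul_eq_mul, mul_assoc, hf.eq]

theorem smul_gen (hf : IsIdempotentElem f) (p : ↥(span A {f})) : (p : A) • gen f = p :=
  Subtype.ext ((mem_span_idem hf).1 p.2)

theorem eq_top_of_gen_mem (hf : IsIdempotentElem f) {N : Submodule A ↥(span A {f})}
    (h : gen f ∈ N) : N = ⊤ :=
  eq_top_iff'.2 fun p => smul_gen hf p ▸ N.smul_mem (p : A) h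

theorem set_smul_top_span_of_mem (hf : IsIdempotentElem f) {S : Set A} (hfS : f ∈ S) :
    S • (⊤ : Submodule A ↥(span A {f})) = ⊤ :=
  eq_top_of_gen_mem hf (smul_gen hf (gen f) ▸ mem_set_smul_of_mem_mem hfS mem_top)

theorem projective_span_idem (hf : IsIdempotentElem f) : Module.Projective A ↥(span A {f}) :=
  Module.Projective.of_split (M := A) (span A {f}).subtype (LinearMap.toSpanSingleton A _ (gen f))
    (LinearMap.ext (smul_gen hf))

theorem evalAt_pow_gen (f : A) (x : ↥(span A {f})) (n : ℕ) :
    (((evalAt f x : Module.End A ↥(span A {f})) ^ n) (gen f) : A) = f * (x : A) ^ n := by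
  induction n with
  | zero => simp [gen]
  | succ n ih =>
    rw [pow_succ', Module.End.mul_apply, evalAt_apply, coe_smul, ih, smul_eq_mul, pow_succ,
      mul_assoc]

theorem isNilpotent_evalAt_iff (hf : IsIdempotentElem f) {x : ↥(span A {f})}
    (hx : f * (x : A) = x) :
    IsNilpotent (evalAt f x : Module.End A ↥(span A {f})) ↔ IsNilpotent (x : A) := by
  constructor <;> rintro ⟨n, hn⟩ <;> have hpow := evalAt_pow_gen f x n <;> rw [hn] at hpow
  · refine ⟨n + 1, ?_⟩
    rw [pow_succ', ← hx, mul_assoc, hx, ← pow_succ', pow_succ, ← mul_assoc, ← hpow]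
    simp
  · refine ⟨n, LinearMap.ext fun p => ?_⟩
    rw [← smul_gen hf p, map_smul, Subtype.ext (hpow.trans (mul_zero f) :
      _ = ((0 : ↥(span A {f})) : A)), LinearMap.zero_apply, smul_zero]

end Principal

section Local

variable {A M : Type*} [Ring A] [AddCommGroup M] [Module A M] {f : A}

theorem nontrivial_span (hf : IsPrimitiveIdempotent f) : Nontrivial ↥(span A {f}) :=
  ⟨gen f, 0, fun h => hf.2.1 (congrArg Subtype.val h)⟩

theorem jacobson_span_ne_top (hf : IsPrimitiveIdempotent f) :
    Module.jacobson A ↥(span A {f}) ≠ ⊤ :=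
  have := nontrivial_span hf
  (Module.jacobson_lt_top A _).ne

theorem gen_notMem_jacobson (hf : IsPrimitiveIdempotent f) :
    gen f ∉ Module.jacobson A ↥(span A {f}) := fun h =>
  jacobson_span_ne_top hf (eq_top_of_gen_mem hf.1 h)

theorem eq_bot_or_eq_bot_of_isCompl (hf : IsPrimitiveIdempotent f)
    {U W : Submodule A ↥(span A {f})} (h : IsCompl U W) : U = ⊥ ∨ W = ⊥ := by
  obtain ⟨u, hu, w, hw, huw⟩ : ∃ u ∈ U, ∃ w ∈ W, u + w = gen f :=
    mem_sup.1 (h.sup_eq_top ▸ mem_top)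
  have hdecomp (x : ↥(span A {f})) : (x : A) • u + (x : A) • w = x := by
    rw [← smul_add, huw, smul_gen hf.1]
  have hU : ∀ x ∈ U, (x : A) • w = 0 := fun x hx =>
    (mem_bot A).1 (h.inf_eq_bot ▸ mem_inf.2
      ⟨eq_sub_of_add_eq' (hdecomp x) ▸ U.sub_mem hx (U.smul_mem _ hu), W.smul_mem _ hw⟩)
  have hW : ∀ x ∈ W, (x : A) • u = 0 := fun x hx =>
    (mem_bot A).1 (h.inf_eq_bot ▸ mem_inf.2
      ⟨U.smul_mem _ hu, eq_sub_of_add_eq (hdecomp x) ▸ W.sub_mem hx (W.smul_mem _ hw)⟩)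
  have hu_idem : (u : A) • u = u := by simpa only [hU u hu, add_zero] using hdecomp u
  have hw_idem : (w : A) • w = w := by simpa only [hW w hw, zero_add] using hdecomp w
  rcases hf.2.2 u w (congrArg Subtype.val hu_idem) (congrArg Subtype.val hw_idem)
    (congrArg Subtype.val (hU u hu)) (congrArg Subtype.val (hW w hw))
    (congrArg Subtype.val huw) with h0 | h0
  · have hu0 : u = 0 := Subtype.ext h0
    refine .inl (eq_bot_iff.2 fun x hx => (mem_bot A).2 ?_)
    rw [← hdecomp x, hU x hx, hu0, smul_zero, add_zero]
  · have hw0 : w = 0 := Subtype.ext h0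
    refine .inr (eq_bot_iff.2 fun x hx => (mem_bot A).2 ?_)
    rw [← hdecomp x, hW x hx, hw0, smul_zero, add_zero]

variable [IsArtinianRing A]

theorem isNilpotent_or_bijective (hf : IsPrimitiveIdempotent f)
    (φ : Module.End A ↥(span A {f})) : IsNilpotent φ ∨ Function.Bijective φ := by
  obtain ⟨n, hcompl, hn⟩ := (φ.eventually_isCompl_ker_pow_range_pow.and
    (Filter.eventually_ge_atTop 1)).exists
  refine (eq_bot_or_eq_bot_of_isCompl hf hcompl).symm.imp
    (fun hrange => ⟨n, LinearMap.range_eq_bot.1 hrange⟩) fun hker => ?_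
  have hinj : Function.Injective ((φ : _ → _)^[n]) := by
    rw [← Module.End.coe_pow]
    exact LinearMap.ker_eq_bot.1 hker
  refine IsArtinian.bijective_of_injective_endomorphism φ (.of_comp (f := φ^[n - 1]) ?_)
  rwa [← Function.iterate_succ, Nat.succ_eq_add_one, Nat.sub_add_cancel hn]

theorem eq_top_or_eq_top_of_sup_eq_top (hf : IsPrimitiveIdempotent f)
    {N L : Submodule A ↥(span A {f})} (h : N ⊔ L = ⊤) : N = ⊤ ∨ L = ⊤ := by
  obtain ⟨n, hn, l, hl, hnl⟩ : ∃ n ∈ N, ∃ l ∈ L, n + l = gen f := mem_sup.1 (h ▸ mem_top)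
  have eq_top_of_surjective {Q : Submodule A ↥(span A {f})} {x} (hx : x ∈ Q)
      (hsurj : Function.Surjective (evalAt f x)) : Q = ⊤ := by
    obtain ⟨a, ha⟩ := hsurj (gen f)
    exact eq_top_of_gen_mem hf.1 (ha ▸ Q.smul_mem _ hx)
  rcases isNilpotent_or_bijective hf (evalAt f n) with hnil | hbij
  · have hl_eq : evalAt f l = 1 - evalAt f n := LinearMap.ext fun x => by
      rw [LinearMap.sub_apply, evalAt_apply, evalAt_apply, Module.End.one_apply,
        eq_sub_iff_add_eq', ← smul_add, hnl, smul_gen hf.1]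
    have hunit : IsUnit (evalAt f l : Module.End A ↥(span A {f})) := hl_eq ▸ hnil.isUnit_one_sub
    exact .inr (eq_top_of_surjective hl ((Module.End.isUnit_iff _).1 hunit).2)
  · exact .inl (eq_top_of_surjective hn hbij.2)

theorem le_jacobson_of_ne_top (hf : IsPrimitiveIdempotent f) {N : Submodule A ↥(span A {f})}
    (hN : N ≠ ⊤) : N ≤ Module.jacobson A ↥(span A {f}) := by
  refine le_sInf fun L hL => by_contra fun h => ?_
  exact (eq_top_or_eq_top_of_sup_eq_top hf (hL.2 (N ⊔ L) (right_lt_sup.2 h))).elim hN hL.1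

theorem isCoatom_jacobson_span (hf : IsPrimitiveIdempotent f) :
    IsCoatom (Module.jacobson A ↥(span A {f})) :=
  ⟨jacobson_span_ne_top hf, fun _ hN => by_contra fun h => hN.not_ge (le_jacobson_of_ne_top hf h)⟩

theorem isSimpleModule_top (hf : IsPrimitiveIdempotent f) :
    IsSimpleModule A (↥(span A {f}) ⧸ Module.jacobson A ↥(span A {f})) :=
  isSimpleModule_iff_isCoatom.2 (isCoatom_jacobson_span hf)

theorem mem_jacobson_iff_range_evalAt_ne_top (hf : IsPrimitiveIdempotent f)
    {x : ↥(span A {f})} (hx : f • x = x) :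
    x ∈ Module.jacobson A ↥(span A {f}) ↔ LinearMap.range (evalAt f x) ≠ ⊤ := by
  refine ⟨fun h htop => jacobson_span_ne_top hf (top_unique (htop ▸ ?_)), fun h =>
    le_jacobson_of_ne_top hf h ⟨gen f, hx⟩⟩
  rintro _ ⟨p, rfl⟩
  exact smul_mem _ _ h

theorem mem_jacobson_iff_isNilpotent (hf : IsPrimitiveIdempotent f) {x : ↥(span A {f})}
    (hx : f * (x : A) = x) :
    x ∈ Module.jacobson A ↥(span A {f}) ↔ IsNilpotent (x : A) := by
  rw [mem_jacobson_iff_range_evalAt_ne_top hf (Subtype.ext hx), Ne, LinearMap.range_eq_top,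
    ← isNilpotent_evalAt_iff hf.1 hx]
  refine ⟨fun h => (isNilpotent_or_bijective hf _).resolve_right fun hbij => h hbij.2, ?_⟩
  rintro ⟨n, hn⟩ hsurj
  obtain ⟨p, hp⟩ := hsurj.iterate n (gen f)
  rw [← Module.End.coe_pow, hn, LinearMap.zero_apply] at hp
  exact hf.2.1 (congrArg Subtype.val hp.symm)

theorem ker_eq_jacobson (hf : IsPrimitiveIdempotent f) [IsSimpleModule A M]
    {g : ↥(span A {f}) →ₗ[A] M} (hg : g ≠ 0) :
    LinearMap.ker g = Module.jacobson A ↥(span A {f}) := by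
  have hcoatom : IsCoatom (LinearMap.ker g) := isSimpleModule_iff_isCoatom.1
    (.congr (g.quotKerEquivOfSurjective (LinearMap.surjective_of_ne_zero hg)))
  exact le_antisymm (le_jacobson_of_ne_top hf hcoatom.1) (sInf_le hcoatom)

theorem nonempty_equiv_top_iff (hf : IsPrimitiveIdempotent f) [IsSimpleModule A M] :
    Nonempty (M ≃ₗ[A] ↥(span A {f}) ⧸ Module.jacobson A ↥(span A {f})) ↔ ∃ x : M, f • x ≠ 0 := by
  constructor
  · rintro ⟨φ⟩
    refine ⟨φ.symm (mkQ _ (gen f)), ?_⟩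
    rw [← map_smul, ← map_smul, show f • gen f = gen f from smul_gen hf.1 (gen f),
      LinearEquiv.map_ne_zero_iff, mkQ_apply, Ne, Quotient.mk_eq_zero]
    exact gen_notMem_jacobson hf
  · rintro ⟨x, hx⟩
    have hg := evalAt_ne_zero hx
    exact ⟨((quotEquivOfEq _ _ (ker_eq_jacobson hf hg).symm).trans
      ((evalAt f x).quotKerEquivOfSurjective (LinearMap.surjective_of_ne_zero hg))).symm⟩

theorem exists_surjective_of_smul_notMem (hf : IsPrimitiveIdempotent f) [Module.Projective A M]
    {N : Submodule A M} (hN : IsCoatom N) {x : M} (hx : f • x ∉ N) :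
    ∃ φ : M →ₗ[A] ↥(span A {f}), Function.Surjective φ := by
  have : IsSimpleModule A (M ⧸ N) := isSimpleModule_iff_isCoatom.2 hN
  have hg : evalAt f (N.mkQ x) ≠ 0 :=
    evalAt_ne_zero fun h => hx ((Quotient.mk_eq_zero N).1 h)
  obtain ⟨φ, hφ⟩ := Module.projective_lifting_property (evalAt f (N.mkQ x)) N.mkQ
    (LinearMap.surjective_of_ne_zero hg)
  refine ⟨φ, LinearMap.range_eq_top.1 (by_contra fun h => hN.1 ?_)⟩
  have hle := le_jacobson_of_ne_top hf h
  rw [← ker_eq_jacobson hf hg, LinearMap.range_le_ker_iff, hφ] at hle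
  rw [← N.ker_mkQ, hle, LinearMap.ker_zero]

theorem exists_split_surjection [Module.Projective A M] [Module.Finite A M] [Nontrivial M]
    {S : Set A} (hS : ∀ f ∈ S, IsPrimitiveIdempotent f) (hM : S • (⊤ : Submodule A M) = ⊤) :
    ∃ f ∈ S, ∃ (φ : M →ₗ[A] ↥(span A {f})) (σ : ↥(span A {f}) →ₗ[A] M),
      φ ∘ₗ σ = LinearMap.id := by
  obtain ⟨N, hN⟩ := IsCoatomic.exists_coatom (Submodule A M)
  have hSN : ¬ S • (⊤ : Submodule A M) ≤ N := fun h => hN.1 (top_unique (hM.ge.trans h))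
  simp only [set_smul_le_iff, not_forall] at hSN
  obtain ⟨f, x, hfS, -, hx⟩ := hSN
  obtain ⟨φ, hφ⟩ := exists_surjective_of_smul_notMem (hS f hfS) hN hx
  have := projective_span_idem (hS f hfS).1
  exact ⟨f, hfS, φ, Module.projective_lifting_property φ LinearMap.id hφ⟩

end Local

section CornerDim

variable (k : Type*) [Field k] {A M M' : Type*} [Ring A] [Algebra k A]
  [AddCommGroup M] [Module A M] [Module k M] [IsScalarTower k A M]
  [AddCommGroup M'] [Module A M'] [Module k M'] [IsScalarTower k A M']

instance finite_submodule [FiniteDimensional k M] (N : Submodule A M) : FiniteDimensional k ↥N :=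
  inferInstanceAs (FiniteDimensional k ↥(N.restrictScalars k))

variable (M) in
/-- The `k`-subspace of the vectors of `M` fixed by `f`. For an idempotent `f` it is `f M`. -/
def fixedBy (f : A) : Submodule k M where
  carrier := {x | f • x = x}
  add_mem' {x y} (hx : f • x = x) (hy : f • y = y) := show f • (x + y) = x + y by
    rw [smul_add, hx, hy]
  zero_mem' := smul_zero f
  smul_mem' c x (hx : f • x = x) := show f • c • x = c • x by rw [smul_algebra_smul_comm, hx]

@[simp]
theorem mem_fixedBy {f : A} {x : M} : x ∈ fixedBy k M f ↔ f • x = x := Iff.rfl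

variable (M) in
/-- The dimension of `f M`, for an idempotent `f`. For a primitive `f` over an algebraically closed
field this is the multiplicity in `M` of the simple module with projective cover `A f`. -/
noncomputable def cornerDim (f : A) : ℕ := Module.finrank k ↥(fixedBy k M f)

theorem cornerDim_congr (φ : M ≃ₗ[A] M') (f : A) : cornerDim k M f = cornerDim k M' f := by
  refine ((φ.restrictScalars k).ofSubmodules (fixedBy k M f) (fixedBy k M' f) ?_).finrank_eq
  ext y
  refine ⟨?_, fun hy => ⟨φ.symm y, ?_, φ.apply_symm_apply y⟩⟩
  · rintro ⟨x, hx, rfl⟩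
    exact (map_smul φ f x).symm.trans (congrArg φ hx)
  · exact (map_smul φ.symm f y).symm.trans (congrArg φ.symm hy)

theorem cornerDim_submodule (f : A) (N : Submodule A M) :
    cornerDim k ↥N f = Module.finrank k ↥(fixedBy k M f ⊓ N.restrictScalars k) := by
  have hmap : (fixedBy k ↥N f).map (N.subtype.restrictScalars k) =
      fixedBy k M f ⊓ N.restrictScalars k := by
    ext x
    constructor
    · rintro ⟨y, hy, rfl⟩
      exact ⟨congrArg Subtype.val hy, y.2⟩
    · rintro ⟨hx, hxN⟩
      exact ⟨⟨x, hxN⟩, Subtype.ext hx, rfl⟩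
  rw [← hmap]
  exact (equivMapOfInjective (N.subtype.restrictScalars k) N.subtype_injective _).finrank_eq

theorem cornerDim_top_submodule (f : A) :
    cornerDim k ↥(⊤ : Submodule A M) f = cornerDim k M f :=
  cornerDim_congr k topEquiv f

variable {k}

theorem cornerDim_eq_zero_iff [FiniteDimensional k M] {f : A} (hf : IsIdempotentElem f) :
    cornerDim k M f = 0 ↔ ∀ x : M, f • x = 0 := by
  rw [cornerDim, finrank_eq_zero, Submodule.eq_bot_iff]
  refine ⟨fun h x => h _ ?_, fun h x hx => hx.symm.trans (h x)⟩
  rw [mem_fixedBy, ← mul_smul, hf.eq]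

theorem cornerDim_quotient_eq_zero_iff [FiniteDimensional k M] {f : A} (hf : IsIdempotentElem f)
    (N : Submodule A M) : cornerDim k (M ⧸ N) f = 0 ↔ ∀ x : M, f • x ∈ N := by
  rw [cornerDim_eq_zero_iff hf, N.mkQ_surjective.forall]
  exact forall_congr' fun x => Quotient.mk_eq_zero N

theorem cornerDim_eq_iff_of_le [FiniteDimensional k M] {f : A} {N N' : Submodule A M}
    (h : N ≤ N') :
    cornerDim k ↥N f = cornerDim k ↥N' f ↔ ∀ x ∈ N', f • x = x → x ∈ N := by
  rw [cornerDim_submodule, cornerDim_submodule]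
  have hle : fixedBy k M f ⊓ N.restrictScalars k ≤ fixedBy k M f ⊓ N'.restrictScalars k :=
    inf_le_inf_left _ h
  refine ⟨fun heq x hxN' hx => ?_, fun hfix => ?_⟩
  · have hx' : x ∈ fixedBy k M f ⊓ N'.restrictScalars k := ⟨hx, hxN'⟩
    exact (eq_of_le_of_finrank_eq hle heq ▸ hx').2
  · rw [hle.antisymm fun x hx => ⟨hx.1, hfix x hx.2 hx.1⟩]

variable (k)

theorem finrank_quotient_add [FiniteDimensional k M] (N : Submodule A M) :
    Module.finrank k (M ⧸ N) + Module.finrank k ↥N = Module.finrank k M :=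
  Submodule.finrank_quotient_add_finrank (N.restrictScalars k)

variable {f : A}

theorem map_mkQ_fixedBy (hf : IsIdempotentElem f) (N : Submodule A M) :
    (fixedBy k M f).map (N.mkQ.restrictScalars k) = fixedBy k (M ⧸ N) f := by
  ext y
  constructor
  · rintro ⟨x, hx, rfl⟩
    exact (map_smul N.mkQ f x).symm.trans (congrArg N.mkQ hx)
  · intro hy
    obtain ⟨x, rfl⟩ := N.mkQ_surjective y
    exact ⟨f • x, by rw [SetLike.mem_coe, mem_fixedBy, ← mul_smul, hf.eq], hy⟩

variable [FiniteDimensional k M]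

theorem cornerDim_add (hf : IsIdempotentElem f) (N : Submodule A M) :
    cornerDim k M f = cornerDim k ↥N f + cornerDim k (M ⧸ N) f := by
  let φ := (N.mkQ.restrictScalars k).domRestrict (fixedBy k M f)
  have hrange : LinearMap.range φ = fixedBy k (M ⧸ N) f := by
    rw [LinearMap.range_domRestrict, map_mkQ_fixedBy k hf]
  have hker : (LinearMap.ker φ).map (fixedBy k M f).subtype =
      fixedBy k M f ⊓ N.restrictScalars k := by
    rw [LinearMap.ker_domRestrict, Submodule.map_comap_subtype]
    congr 1
    exact SetLike.ext fun x => (LinearMap.mem_ker.trans (Quotient.mk_eq_zero N))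
  rw [cornerDim_submodule, ← hker, cornerDim, cornerDim, ← hrange, finrank_map_subtype_eq,
    add_comm, LinearMap.finrank_range_add_finrank_ker]

theorem cornerDim_add_submoduleOf (hf : IsIdempotentElem f) {N N' : Submodule A M} (h : N ≤ N') :
    cornerDim k ↥N' f = cornerDim k ↥N f + cornerDim k (↥N' ⧸ N.submoduleOf N') f := by
  rw [cornerDim_add k hf (N.submoduleOf N'), cornerDim_congr k (submoduleOfEquivOfLe h)]

theorem cornerDim_eq_sum_of_monotone (hf : IsIdempotentElem f) {n : ℕ}
    {F : Fin (n + 1) → Submodule A M} (hF : Monotone F) (h0 : F 0 = ⊥) :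
    cornerDim k ↥(F (Fin.last n)) f =
      ∑ i : Fin n, cornerDim k (↥(F i.succ) ⧸ (F i.castSucc).submoduleOf (F i.succ)) f := by
  induction n with
  | zero =>
    rw [Fin.sum_univ_zero, cornerDim_eq_zero_iff hf, show F (Fin.last 0) = ⊥ from h0]
    exact fun x => Subsingleton.elim _ _
  | succ n ih =>
    rw [Fin.sum_univ_castSucc, ← Fin.succ_last,
      cornerDim_add_submoduleOf k hf (hF (Fin.castSucc_le_succ _)),
      ih (F := fun i => F i.castSucc) (hF.comp Fin.strictMono_castSucc.monotone) h0]
    rfl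

end CornerDim

section Multiplicity

variable (k : Type*) [Field k] [IsAlgClosed k] {A M : Type*} [Ring A] [Algebra k A]
  [FiniteDimensional k A] [AddCommGroup M] [Module A M] [Module k M] [IsScalarTower k A M] {f : A}

theorem cornerDim_top (hf : IsPrimitiveIdempotent f) :
    cornerDim k (↥(span A {f}) ⧸ Module.jacobson A ↥(span A {f})) f = 1 := by
  have := IsArtinianRing.of_finite k A
  have := isSimpleModule_top hf
  set R := Module.jacobson A ↥(span A {f})
  have hgen : f • R.mkQ (gen f) = R.mkQ (gen f) :=
    (map_smul R.mkQ f _).symm.trans (congrArg R.mkQ (smul_gen hf.1 (gen f)))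
  refine (finrank_eq_one_iff_of_nonzero' (⟨R.mkQ (gen f), hgen⟩ : ↥(fixedBy k _ f)) ?_).2 ?_
  · exact fun h => gen_notMem_jacobson hf ((Quotient.mk_eq_zero _).1 (congrArg Subtype.val h))
  · rintro ⟨x, hx : f • x = x⟩
    by_cases hx0 : x = 0
    · exact ⟨0, Subtype.ext (by simp [hx0])⟩
    have hg : evalAt f x ≠ 0 := evalAt_ne_zero (by rwa [hx])
    let ψ : Module.End A (↥(span A {f}) ⧸ R) := R.liftQ (evalAt f x) (ker_eq_jacobson hf hg).ge
    have hψ : ψ (R.mkQ (gen f)) = x := hx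
    obtain ⟨c, hc⟩ := (IsSimpleModule.algebraMap_end_bijective_of_isAlgClosed (A := A)
      (V := ↥(span A {f}) ⧸ R) k).2 ψ
    exact ⟨c, Subtype.ext ((LinearMap.congr_fun hc (R.mkQ (gen f))).trans hψ)⟩

variable [FiniteDimensional k M]

open Classical in
theorem cornerDim_of_simple (hf : IsPrimitiveIdempotent f) [IsSimpleModule A M] :
    cornerDim k M f =
      if Nonempty (M ≃ₗ[A] ↥(span A {f}) ⧸ Module.jacobson A ↥(span A {f})) then 1 else 0 := by
  have := IsArtinianRing.of_finite k A
  split_ifs with h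
  · rw [cornerDim_congr k h.some, cornerDim_top k hf]
  · rw [cornerDim_eq_zero_iff hf.1]
    simpa only [nonempty_equiv_top_iff hf, not_exists, not_not] using h

theorem ncard_factors_eq_cornerDim (hf : IsPrimitiveIdempotent f)
    {s : CompositionSeries (Submodule A M)} (hhead : s.head = ⊥) (hlast : s.last = ⊤) :
    Set.ncard {i : Fin s.length |
      Nonempty ((↥(s i.succ) ⧸ (s i.castSucc).submoduleOf (s i.succ)) ≃ₗ[A]
        ↥(span A {f}) ⧸ Module.jacobson A ↥(span A {f}))} = cornerDim k M f := by
  classical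
  have hsum := cornerDim_eq_sum_of_monotone k hf.1 (F := s) s.strictMono.monotone hhead
  have hsimple (i : Fin s.length) :
      IsSimpleModule A (↥(s i.succ) ⧸ (s i.castSucc).submoduleOf (s i.succ)) :=
    (covBy_iff_quot_is_simple (s.step i).le).1 (s.step i)
  rw [show s (Fin.last s.length) = ⊤ from hlast, cornerDim_top_submodule] at hsum
  rw [hsum, Finset.sum_congr rfl fun i _ => cornerDim_of_simple k hf, ← Finset.card_filter,
    Set.ncard_eq_toFinset_card', Set.toFinset_ofPred]

theorem hasMultiplicity_iff {Λ : Type*} {e : Λ → A} (hprim : ∀ l, IsPrimitiveIdempotent (e l))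
    (m : Λ) (n : ℕ) : HasMultiplicity A M (SimpleMod e m) n ↔ cornerDim k M (e m) = n := by
  constructor
  · rintro ⟨s, hhead, hlast, rfl⟩
    exact (ncard_factors_eq_cornerDim k (hprim m) hhead hlast).symm
  · rintro rfl
    have : IsNoetherian A M := isNoetherian_of_tower k inferInstance
    have : IsArtinian A M := isArtinian_of_tower k inferInstance
    obtain ⟨s, hhead, hlast⟩ := exists_compositionSeries_of_isNoetherian_isArtinian A M
    exact ⟨s, hhead, hlast, ncard_factors_eq_cornerDim k (hprim m) hhead hlast⟩

end Multiplicity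

section Kernels

variable {A : Type*} [Ring A] {f : A}

/-- The nilpotent elements of `f A f`. They generate the radical of `A f` up to composition factors
other than the top of `A f`. -/
def nilCorner (f : A) : Set A := {x | f * x = x ∧ x * f = x ∧ IsNilpotent x}

variable {Λ : Type*} {e : Λ → A}

theorem smul_mem_jacobson_of_ne [IsArtinianRing A] (hprim : ∀ l, IsPrimitiveIdempotent (e l))
    (hbasic : IsBasic e) {l m : Λ} (h : m ≠ l) (x : ↥(ProjMod e l)) :
    e m • x ∈ Module.jacobson A ↥(ProjMod e l) := by
  by_contra hx
  have := projective_span_idem (hprim l).1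
  have := projective_span_idem (hprim m).1
  obtain ⟨φ, hφ⟩ :=
    exists_surjective_of_smul_notMem (hprim m) (isCoatom_jacobson_span (hprim l)) hx
  obtain ⟨σ, hσ⟩ := Module.projective_lifting_property φ LinearMap.id hφ
  have hσφ : IsIdempotentElem (σ ∘ₗ φ) := by
    rw [IsIdempotentElem, Module.End.mul_eq_comp, LinearMap.comp_assoc, ← LinearMap.comp_assoc φ,
      hσ, LinearMap.id_comp]
  rcases eq_bot_or_eq_bot_of_isCompl (hprim l)
      (LinearMap.IsIdempotentElem.isCompl hσφ) with h0 | h0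
  · have hσ0 : σ (gen (e m)) = 0 := by
      obtain ⟨y, hy⟩ := hφ (gen (e m))
      rw [← hy]
      exact LinearMap.congr_fun (LinearMap.range_eq_bot.1 h0) y
    have hgen : φ (σ (gen (e m))) = gen (e m) := LinearMap.congr_fun hσ _
    rw [hσ0, map_zero] at hgen
    exact (hprim m).2.1 (congrArg Subtype.val hgen.symm)
  · have hinj : Function.Injective (σ ∘ φ) := LinearMap.ker_eq_bot.1 h0
    exact (hbasic l m h.symm).false (.ofBijective φ ⟨hinj.of_comp, hφ⟩)

theorem nilCorner_smul_top_le_jacobson [IsArtinianRing A] (hf : IsPrimitiveIdempotent f) :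
    nilCorner f • (⊤ : Submodule A ↥(span A {f})) ≤ Module.jacobson A ↥(span A {f}) := by
  refine set_smul_le _ _ _ fun s x hs _ => ?_
  exact Module.le_comap_jacobson (evalAt f x) ((mem_jacobson_iff_isNilpotent hf
    (x := ⟨s, (mem_span_idem hf.1).2 hs.2.1⟩) hs.1).2 hs.2.2)

theorem set_smul_top_le_jacobson [IsArtinianRing A] (hprim : ∀ l, IsPrimitiveIdempotent (e l))
    (hbasic : IsBasic e) {T : Set Λ} {l : Λ} (hl : l ∉ T) :
    (e '' T ∪ nilCorner (e l)) • (⊤ : Submodule A ↥(ProjMod e l)) ≤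
      Module.jacobson A ↥(ProjMod e l) := by
  refine set_smul_le _ _ _ ?_
  rintro _ x (⟨t, ht, rfl⟩ | hs) -
  · exact smul_mem_jacobson_of_ne hprim hbasic (ne_of_mem_of_not_mem ht hl) x
  · exact nilCorner_smul_top_le_jacobson (hprim l) (mem_set_smul_of_mem_mem hs mem_top)

theorem mem_jacobson_iff_mem_nilCorner_smul [IsArtinianRing A] (hf : IsPrimitiveIdempotent f)
    {x : ↥(span A {f})} (hx : f • x = x) : x ∈ Module.jacobson A ↥(span A {f}) ↔
      x ∈ nilCorner f • (⊤ : Submodule A ↥(span A {f})) := by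
  refine ⟨fun h => ?_, fun h => nilCorner_smul_top_le_jacobson hf h⟩
  have hxval : f * (x : A) = x := congrArg Subtype.val hx
  rw [← smul_gen hf.1 x]
  exact mem_set_smul_of_mem_mem ⟨hxval, (mem_span_idem hf.1).1 x.2,
    (mem_jacobson_iff_isNilpotent hf hxval).1 h⟩ mem_top

variable (k : Type*) [Field k] [Algebra k A] [FiniteDimensional k A] [IsAlgClosed k]

theorem cornerDim_quotient_eq_one_iff (hf : IsPrimitiveIdempotent f)
    {K : Submodule A ↥(span A {f})} : cornerDim k (↥(span A {f}) ⧸ K) f = 1 ↔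
      K ≤ Module.jacobson A ↥(span A {f}) ∧ nilCorner f • ⊤ ≤ K := by
  have := IsArtinianRing.of_finite k A
  set R := Module.jacobson A ↥(span A {f})
  have hK := cornerDim_add k hf.1 K
  have hR := cornerDim_add k hf.1 R
  rw [cornerDim_top k hf] at hR
  have hle (hKR : K ≤ R) : cornerDim k (↥(span A {f}) ⧸ K) f = 1 ↔ nilCorner f • ⊤ ≤ K := by
    rw [show cornerDim k (↥(span A {f}) ⧸ K) f = 1 ↔ cornerDim k ↥K f = cornerDim k ↥R f by
      omega, cornerDim_eq_iff_of_le hKR]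
    refine ⟨fun h => set_smul_le _ _ _ fun s x hs hx => h _ ?_ ?_, fun h x hxR hx =>
      h ((mem_jacobson_iff_mem_nilCorner_smul hf hx).1 hxR)⟩
    · exact nilCorner_smul_top_le_jacobson hf (mem_set_smul_of_mem_mem hs hx)
    · rw [← mul_smul, hs.1]
  refine ⟨fun h => ?_, fun h => (hle h.1).2 h.2⟩
  have hKR : K ≤ R := le_jacobson_of_ne_top hf fun htop => by
    subst htop
    rw [(cornerDim_eq_zero_iff hf.1).2 fun x => Subsingleton.elim _ _] at h
    exact zero_ne_one h
  exact ⟨hKR, (hle hKR).1 h⟩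

include k

theorem forall_hasMultiplicity_zero_iff (hprim : ∀ l, IsPrimitiveIdempotent (e l)) {M : Type*}
    [AddCommGroup M] [Module A M] [Module k M] [IsScalarTower k A M] [FiniteDimensional k M]
    (T : Set Λ) (N : Submodule A M) :
    (∀ m ∈ T, HasMultiplicity A (M ⧸ N) (SimpleMod e m) 0) ↔ (e '' T) • ⊤ ≤ N := by
  simp only [hasMultiplicity_iff k hprim, cornerDim_quotient_eq_zero_iff (hprim _).1]
  refine ⟨fun h => set_smul_le _ _ _ ?_, fun h m hm x =>
    h (mem_set_smul_of_mem_mem (Set.mem_image_of_mem e hm) mem_top)⟩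
  rintro _ x ⟨m, hm, rfl⟩ -
  exact h m hm x

theorem cornerDim_quotient_set_smul_self (hprim : ∀ l, IsPrimitiveIdempotent (e l))
    (hbasic : IsBasic e) {T : Set Λ} {l : Λ} (hl : l ∉ T) :
    cornerDim k (↥(ProjMod e l) ⧸ (e '' T ∪ nilCorner (e l)) •
      (⊤ : Submodule A ↥(ProjMod e l))) (e l) = 1 := by
  have := IsArtinianRing.of_finite k A
  exact (cornerDim_quotient_eq_one_iff k (hprim l)).2
    ⟨set_smul_top_le_jacobson hprim hbasic hl, set_smul_mono_left ⊤ Set.subset_union_right⟩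

variable [LinearOrder Λ]

theorem standardKer_eq (hprim : ∀ l, IsPrimitiveIdempotent (e l)) (l : Λ) :
    standardKer e l = (e '' Set.Ioi l) • ⊤ := by
  rw [standardKer, ← csInf_Ici (a := (e '' Set.Ioi l) • (⊤ : Submodule A ↥(ProjMod e l)))]
  congr 1 with N
  simp only [not_le]
  exact forall_hasMultiplicity_zero_iff k hprim (Set.Ioi l) N

theorem properStandardKer_eq (hprim : ∀ l, IsPrimitiveIdempotent (e l)) (hbasic : IsBasic e)
    (l : Λ) : properStandardKer e l = (e '' Set.Ioi l ∪ nilCorner (e l)) • ⊤ := by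
  have := IsArtinianRing.of_finite k A
  set R := Module.jacobson A ↥(ProjMod e l)
  have hsup : (e '' Set.Ioi l ∪ nilCorner (e l)) • (⊤ : Submodule A ↥(ProjMod e l)) =
      (e '' Set.Ioi l) • ⊤ ⊔ nilCorner (e l) • ⊤ := sup_set_smul _ _ _
  have hset : {N : Submodule A ↥(ProjMod e l) |
      HasMultiplicity A (↥(ProjMod e l) ⧸ N) (SimpleMod e l) 1 ∧ ∀ m : Λ, m ≠ l → ¬ m < l →
        HasMultiplicity A (↥(ProjMod e l) ⧸ N) (SimpleMod e m) 0} =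
      Set.Icc ((e '' Set.Ioi l ∪ nilCorner (e l)) • ⊤) R := by
    ext N
    have hIoi : (∀ m : Λ, m ≠ l → ¬ m < l →
        HasMultiplicity A (↥(ProjMod e l) ⧸ N) (SimpleMod e m) 0) ↔
          (e '' Set.Ioi l) • ⊤ ≤ N := by
      rw [← forall_hasMultiplicity_zero_iff k hprim]
      exact forall_congr' fun m => ⟨fun h hm => h hm.ne' hm.not_gt, fun h hne hlt =>
        h (lt_of_le_of_ne (not_lt.1 hlt) hne.symm)⟩
    rw [Set.mem_ofPred_eq, hIoi, hasMultiplicity_iff k hprim,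
      cornerDim_quotient_eq_one_iff k (hprim l), hsup, Set.mem_Icc, sup_le_iff]
    tauto
  rw [properStandardKer, hset,
    csInf_Icc (set_smul_top_le_jacobson hprim hbasic Set.self_notMem_Ioi)]

end Kernels

section Filtration

variable {A M M' : Type*} [Ring A] [AddCommGroup M] [Module A M] [AddCommGroup M'] [Module A M']
  {ι : Type*} (X : ι → Type*) [∀ i, AddCommGroup (X i)] [∀ i, Module A (X i)]

/-- `N ≤ N'` are consecutive terms of a filtration with factors in the family `X`. -/
def FiltStep (N N' : Submodule A M) : Prop :=
  N ≤ N' ∧ ∃ i, Nonempty ((↥N' ⧸ N.submoduleOf N') ≃ₗ[A] X i)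

variable {X}

theorem exists_chain_of_reflTransGen {N N' : Submodule A M}
    (h : Relation.ReflTransGen (FiltStep X) N N') :
    ∃ (n : ℕ) (F : Fin (n + 1) → Submodule A M), F 0 = N ∧ F (Fin.last n) = N' ∧
      ∀ j : Fin n, FiltStep X (F j.castSucc) (F j.succ) := by
  induction h with
  | refl => exact ⟨0, fun _ => N, rfl, rfl, fun j => j.elim0⟩
  | @tail L L' _ hstep ih =>
    obtain ⟨n, F, h0, hlast, hF⟩ := ih
    refine ⟨n + 1, Fin.snoc (α := fun _ => Submodule A M) F L', ?_, Fin.snoc_last _ _,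
      Fin.lastCases ?_ fun j => ?_⟩
    · rw [← Fin.castSucc_zero, Fin.snoc_castSucc, h0]
    · rwa [Fin.succ_last, Fin.snoc_last, Fin.snoc_castSucc, hlast]
    · rw [Fin.succ_castSucc, Fin.snoc_castSucc, Fin.snoc_castSucc]
      exact hF j

theorem hasFiltrationBy_iff_reflTransGen :
    HasFiltrationBy A M X ↔ Relation.ReflTransGen (FiltStep X) (⊥ : Submodule A M) ⊤ := by
  constructor
  · rintro ⟨n, F, hmono, h0, hlast, hF⟩
    rw [← hlast]
    induction Fin.last n using Fin.induction with
    | zero => rw [h0]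
    | succ i ih => exact ih.tail ⟨hmono (Fin.castSucc_le_succ i), hF i⟩
  · intro h
    obtain ⟨n, F, h0, hlast, hF⟩ := exists_chain_of_reflTransGen h
    exact ⟨n, F, Fin.monotone_iff_le_succ.2 fun j => (hF j).1, h0, hlast, fun j => (hF j).2⟩

theorem filtStep_of_surjective {N N' : Submodule A M} (h : N ≤ N') {i : ι} {g : ↥N' →ₗ[A] X i}
    (hg : Function.Surjective g) (hker : LinearMap.ker g = N.submoduleOf N') : FiltStep X N N' :=
  ⟨h, i, ⟨(quotEquivOfEq _ _ hker.symm).trans (g.quotKerEquivOfSurjective hg)⟩⟩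

theorem FiltStep.map {φ : M →ₗ[A] M'} (hφ : Function.Injective φ) {N N' : Submodule A M}
    (h : FiltStep X N N') : FiltStep X (N.map φ) (N'.map φ) := by
  obtain ⟨hN, i, ⟨ψ⟩⟩ := h
  let E := equivMapOfInjective φ hφ N'
  refine filtStep_of_surjective (map_mono hN) (i := i)
    (g := ψ.toLinearMap ∘ₗ (N.submoduleOf N').mkQ ∘ₗ E.symm.toLinearMap)
    (ψ.surjective.comp ((mkQ_surjective _).comp E.symm.surjective)) ?_
  ext y
  obtain ⟨x, rfl⟩ := E.surjective y
  simp only [LinearMap.mem_ker, LinearMap.comp_apply, LinearEquiv.coe_coe, ψ.map_eq_zero_iff,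
    E.symm_apply_apply, mkQ_apply, Quotient.mk_eq_zero]
  exact hφ.mem_set_image.symm

theorem FiltStep.comap {φ : M →ₗ[A] M'} (hφ : Function.Surjective φ) {N N' : Submodule A M'}
    (h : FiltStep X N N') : FiltStep X (N.comap φ) (N'.comap φ) := by
  obtain ⟨hN, i, ⟨ψ⟩⟩ := h
  let π : ↥(N'.comap φ) →ₗ[A] ↥N' := φ.restrict fun x hx => hx
  have hπ : Function.Surjective π := by
    rintro ⟨y, hy⟩
    obtain ⟨x, rfl⟩ := hφ y
    exact ⟨⟨x, hy⟩, rfl⟩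
  refine filtStep_of_surjective (comap_mono hN) (i := i)
    (g := ψ.toLinearMap ∘ₗ (N.submoduleOf N').mkQ ∘ₗ π)
    (ψ.surjective.comp ((mkQ_surjective _).comp hπ)) ?_
  ext x
  simp only [LinearMap.mem_ker, LinearMap.comp_apply, LinearEquiv.coe_coe, ψ.map_eq_zero_iff,
    mkQ_apply, Quotient.mk_eq_zero]
  rfl

theorem hasFiltrationBy_of_surjective {φ : M →ₗ[A] M'} (hφ : Function.Surjective φ)
    (hker : HasFiltrationBy A ↥(LinearMap.ker φ) X) (hM' : HasFiltrationBy A M' X) :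
    HasFiltrationBy A M X := by
  rw [hasFiltrationBy_iff_reflTransGen] at *
  have hlower := hker.lift (Submodule.map (LinearMap.ker φ).subtype)
    fun _ _ h => h.map (LinearMap.ker φ).subtype_injective
  have hupper := hM'.lift (Submodule.comap φ) fun _ _ h => h.comap hφ
  rw [Function.onFun, Submodule.map_bot, map_subtype_top] at hlower
  rw [Function.onFun, comap_bot, comap_top] at hupper
  exact hlower.trans hupper

theorem hasFiltrationBy_of_subsingleton [Subsingleton M] : HasFiltrationBy A M X :=
  hasFiltrationBy_iff_reflTransGen.2 (Subsingleton.elim (⊥ : Submodule A M) ⊤ ▸ .refl)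

theorem HasFiltrationBy.congr (ψ : M ≃ₗ[A] M') (h : HasFiltrationBy A M X) :
    HasFiltrationBy A M' X := by
  have : Subsingleton ↥(LinearMap.ker ψ.symm.toLinearMap) := by
    rw [LinearEquiv.ker]
    infer_instance
  exact hasFiltrationBy_of_surjective (φ := ψ.symm.toLinearMap) ψ.symm.surjective
    hasFiltrationBy_of_subsingleton h

theorem hasFiltrationBy_of_quotient (L : Submodule A M) (h : HasFiltrationBy A ↥L X)
    (h' : HasFiltrationBy A (M ⧸ L) X) : HasFiltrationBy A M X :=
  hasFiltrationBy_of_surjective L.mkQ_surjective (h.congr (.ofEq _ _ L.ker_mkQ.symm)) h'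

theorem hasFiltrationBy_of_equiv (i : ι) (ψ : M ≃ₗ[A] X i) : HasFiltrationBy A M X :=
  hasFiltrationBy_iff_reflTransGen.2 (.single (filtStep_of_surjective bot_le
    (g := ψ.toLinearMap ∘ₗ (⊤ : Submodule A M).subtype)
    (ψ.surjective.comp topEquiv.surjective) (by
      rw [LinearMap.ker_comp, LinearEquiv.ker]
      rfl)))

theorem HasFiltrationBy.refine {κ : Type*} {Y : κ → Type*} [∀ i, AddCommGroup (Y i)]
    [∀ i, Module A (Y i)] (h : HasFiltrationBy A M X) (hX : ∀ i, HasFiltrationBy A (X i) Y) :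
    HasFiltrationBy A M Y := by
  rw [hasFiltrationBy_iff_reflTransGen] at h
  refine HasFiltrationBy.congr topEquiv ?_
  generalize (⊤ : Submodule A M) = N at h ⊢
  induction h with
  | refl => exact hasFiltrationBy_of_subsingleton
  | tail _ hstep ih =>
    obtain ⟨hle, i, ⟨ψ⟩⟩ := hstep
    exact hasFiltrationBy_of_quotient _ (ih.congr (submoduleOfEquivOfLe hle).symm)
      ((hX i).congr ψ.symm)

end Filtration

section Trace

variable {A M : Type*} [Ring A] [AddCommGroup M] [Module A M]

theorem set_smul_eq_of_set_smul_le {S : Set A} (hS : ∀ s ∈ S, IsIdempotentElem s)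
    {N N' : Submodule A M} (hN : N ≤ N') (h : S • N' ≤ N) : S • N' = S • N :=
  le_antisymm ((set_smul_set_smul_of_isIdempotentElem hS N').ge.trans (smul_mono_right S h))
    (smul_mono_right S hN)

theorem le_set_smul_set_smul {S T : Set A} (h : ∀ s ∈ S, ∃ t ∈ T, t * s = s)
    (N : Submodule A M) : S • N ≤ T • (S • N) :=
  set_smul_le S N _ fun s x hs hx => by
    obtain ⟨t, ht, hts⟩ := h s hs
    rw [← hts, mul_smul]
    exact mem_set_smul_of_mem_mem ht (mem_set_smul_of_mem_mem hs hx)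

theorem set_smul_sup (S : Set A) (N N' : Submodule A M) : S • (N ⊔ N') = S • N ⊔ S • N' := by
  refine le_antisymm (set_smul_le S _ _ fun s x hs hx => ?_)
    (sup_le (smul_mono_right S le_sup_left) (smul_mono_right S le_sup_right))
  obtain ⟨y, hy, z, hz, rfl⟩ := mem_sup.1 hx
  rw [smul_add]
  exact add_mem_sup (mem_set_smul_of_mem_mem hs hy) (mem_set_smul_of_mem_mem hs hz)

variable {f : A} {S : Set A} {K : Submodule A ↥(span A {f})} {N N' : Submodule A M}

theorem set_smul_le_of_factor_equiv (hS : S • (⊤ : Submodule A ↥(span A {f})) ≤ K)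
    (φ : (↥N' ⧸ N.submoduleOf N') ≃ₗ[A] ↥(span A {f}) ⧸ K) : S • N' ≤ N := by
  refine set_smul_le S N' N fun s x hs hx => ?_
  obtain ⟨p, hp⟩ := K.mkQ_surjective (φ (mkQ _ ⟨x, hx⟩))
  have hsp : K.mkQ (s • p) = 0 :=
    (Quotient.mk_eq_zero K).2 (hS (mem_set_smul_of_mem_mem hs mem_top))
  rw [map_smul, hp, ← map_smul, ← map_smul, φ.map_eq_zero_iff, mkQ_apply,
    Quotient.mk_eq_zero] at hsp
  exact hsp

theorem exists_lift_of_factor_equiv (hf : IsIdempotentElem f) (hN : N ≤ N')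
    (φ : (↥N' ⧸ N.submoduleOf N') ≃ₗ[A] ↥(span A {f}) ⧸ K) :
    ∃ ψ : ↥(span A {f}) →ₗ[A] M, LinearMap.range ψ ⊔ N = N' ∧ N.comap ψ = K := by
  have := projective_span_idem hf
  let g : ↥(span A {f}) →ₗ[A] ↥N' ⧸ N.submoduleOf N' := φ.symm.toLinearMap ∘ₗ K.mkQ
  obtain ⟨ψ, hψ⟩ := Module.projective_lifting_property (N.submoduleOf N').mkQ g (mkQ_surjective _)
  refine ⟨N'.subtype ∘ₗ ψ, le_antisymm (sup_le ?_ hN) fun y hy => ?_, ?_⟩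
  · rintro _ ⟨p, rfl⟩
    exact (ψ p).2
  · obtain ⟨p, hp⟩ : ∃ p, g p = mkQ _ ⟨y, hy⟩ :=
      (φ.symm.surjective.comp K.mkQ_surjective) _
    have hdiff : ⟨y, hy⟩ - ψ p ∈ N.submoduleOf N' := by
      rw [← Quotient.mk_eq_zero, ← mkQ_apply, map_sub, ← hp, ← hψ, LinearMap.comp_apply, sub_self]
    exact mem_sup.2 ⟨ψ p, ⟨p, rfl⟩, _, hdiff, add_sub_cancel _ _⟩
  · ext p
    have hp : (N.submoduleOf N').mkQ (ψ p) = φ.symm (K.mkQ p) := LinearMap.congr_fun hψ p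
    calc (ψ p : M) ∈ N ↔ (N.submoduleOf N').mkQ (ψ p) = 0 := by
          rw [mkQ_apply, Quotient.mk_eq_zero, submoduleOf, mem_comap, subtype_apply]
      _ ↔ p ∈ K := by
          rw [hp, φ.symm.map_eq_zero_iff, mkQ_apply, Quotient.mk_eq_zero]

theorem set_smul_sup_inf_of_factor_equiv (hf : IsIdempotentElem f) (hfS : f ∈ S) (hK : K ≤ S • K)
    (hN : N ≤ N') (φ : (↥N' ⧸ N.submoduleOf N') ≃ₗ[A] ↥(span A {f}) ⧸ K) :
    S • N' ⊔ N = N' ∧ S • N' ⊓ N = S • N := by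
  obtain ⟨ψ, hsup, hcomap⟩ := exists_lift_of_factor_equiv hf hN φ
  have hrange : S • LinearMap.range ψ = LinearMap.range ψ := by
    rw [LinearMap.range_eq_map, ← map_set_smul, set_smul_top_span_of_mem hf hfS]
  have hinf : LinearMap.range ψ ⊓ N ≤ S • N := by
    rw [← map_comap_eq, hcomap]
    refine (map_mono hK).trans ((map_set_smul S K ψ).le.trans (smul_mono_right S ?_))
    exact map_le_iff_le_comap.2 hcomap.ge
  have hsmul : S • N' = LinearMap.range ψ ⊔ S • N := by rw [← hsup, set_smul_sup, hrange]
  constructor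
  · rw [hsmul, sup_assoc, sup_eq_right.2 (set_smul_le_self S N), hsup]
  · rw [hsmul, sup_comm, sup_inf_assoc_of_le _ (set_smul_le_self S N), sup_eq_left.2 hinf]

theorem nonempty_set_smul_factor_equiv (hf : IsIdempotentElem f) (hfS : f ∈ S) (hK : K ≤ S • K)
    (hN : N ≤ N') (φ : (↥N' ⧸ N.submoduleOf N') ≃ₗ[A] ↥(span A {f}) ⧸ K) :
    Nonempty ((↥(S • N') ⧸ (S • N).submoduleOf (S • N')) ≃ₗ[A] ↥(span A {f}) ⧸ K) := by
  obtain ⟨hsup, hinf⟩ := set_smul_sup_inf_of_factor_equiv hf hfS hK hN φ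
  have ψ := LinearMap.quotientInfEquivSupQuotient (S • N') N
  rw [← comap_inf, hsup, hinf] at ψ
  exact ⟨ψ.trans φ⟩

theorem projective_of_submodule_of_quotient (L : Submodule A M) [Module.Projective A ↥L]
    [Module.Projective A (M ⧸ L)] : Module.Projective A M := by
  obtain ⟨s, hs⟩ := Module.projective_lifting_property L.mkQ LinearMap.id L.mkQ_surjective
  exact .of_equiv ((LinearMap.exact_subtype_mkQ L).splitSurjectiveEquiv L.injective_subtype
    ⟨s, hs⟩).1.symm

variable {Λ : Type*} {e : Λ → A} {K : ∀ κ, Submodule A ↥(ProjMod e κ)}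

theorem projective_set_smul_top {T : Set Λ} (hidem : ∀ l, IsIdempotentElem (e l))
    (hF : HasFiltrationBy A M fun κ => ↥(ProjMod e κ) ⧸ K κ)
    (hker : ∀ κ ∉ T, (e '' T) • ⊤ ≤ K κ) (hproj : ∀ κ ∈ T, K κ = ⊥) :
    Module.Projective A ↥((e '' T) • (⊤ : Submodule A M)) := by
  have hS : ∀ s ∈ e '' T, IsIdempotentElem s := Set.forall_mem_image.2 fun t _ => hidem t
  rw [hasFiltrationBy_iff_reflTransGen] at hF
  generalize (⊤ : Submodule A M) = L at hF ⊢
  induction hF with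
  | refl =>
    rw [set_smul_bot]
    infer_instance
  | @tail N N' _ hstep ih =>
    obtain ⟨hN, κ, ⟨φ⟩⟩ := hstep
    by_cases hκ : κ ∈ T
    · obtain ⟨ψ⟩ := nonempty_set_smul_factor_equiv (hidem κ) (Set.mem_image_of_mem e hκ)
        (hproj κ hκ ▸ bot_le) hN φ
      have := projective_span_idem (hidem κ)
      have := Module.Projective.of_equiv (ψ.trans (quotEquivOfEqBot _ (hproj κ hκ))).symm
      have := Module.Projective.of_equiv
        (submoduleOfEquivOfLe (smul_mono_right (e '' T) hN)).symm
      exact projective_of_submodule_of_quotient ((e '' T • N).submoduleOf (e '' T • N'))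
    · rwa [set_smul_eq_of_set_smul_le hS hN (set_smul_le_of_factor_equiv (hker κ hκ) φ)]

theorem cornerDim_set_smul_top_eq_sum (k : Type*) [Field k] [Algebra k A] [Module k M]
    [IsScalarTower k A M] [FiniteDimensional k A] [FiniteDimensional k M]
    {T : Finset Λ} (hidem : ∀ l, IsIdempotentElem (e l))
    (hF : HasFiltrationBy A M fun κ => ↥(ProjMod e κ) ⧸ K κ)
    (hker : ∀ κ ∉ T, (e '' T) • ⊤ ≤ K κ) (hgen : ∀ κ ∈ T, K κ ≤ (e '' T) • K κ)
    (hone : ∀ κ ∈ T, cornerDim k (↥(ProjMod e κ) ⧸ K κ) (e κ) = 1)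
    (hzero : ∀ κ ∈ T, ∀ κ' ∈ T, κ ≠ κ' → cornerDim k (↥(ProjMod e κ) ⧸ K κ) (e κ') = 0)
    {f : A} (hf : IsIdempotentElem f) :
    cornerDim k ↥((e '' T) • (⊤ : Submodule A M)) f =
      ∑ κ ∈ T, cornerDim k M (e κ) * cornerDim k (↥(ProjMod e κ) ⧸ K κ) f := by
  classical
  have hS : ∀ s ∈ e '' (T : Set Λ), IsIdempotentElem s := Set.forall_mem_image.2 fun t _ => hidem t
  rw [hasFiltrationBy_iff_reflTransGen] at hF
  simp only [← cornerDim_top_submodule k (M := M)]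
  generalize (⊤ : Submodule A M) = L at hF ⊢
  induction hF with
  | refl =>
    have hbot {f : A} (hf : IsIdempotentElem f) : cornerDim k ↥(⊥ : Submodule A M) f = 0 :=
      (cornerDim_eq_zero_iff hf).2 fun _ => Subsingleton.elim _ _
    rw [set_smul_bot, hbot hf]
    simp only [hbot (hidem _), zero_mul, Finset.sum_const_zero]
  | @tail N N' _ hstep ih =>
    obtain ⟨hN, κ, ⟨φ⟩⟩ := hstep
    have hadd (κ') : cornerDim k ↥N' (e κ') =
        cornerDim k ↥N (e κ') + cornerDim k (↥(ProjMod e κ) ⧸ K κ) (e κ') := by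
      rw [cornerDim_add_submoduleOf k (hidem κ') hN, cornerDim_congr k φ]
    simp only [hadd, add_mul, Finset.sum_add_distrib, ← ih]
    by_cases hκ : κ ∈ T
    · obtain ⟨ψ⟩ := nonempty_set_smul_factor_equiv (hidem κ)
        (Set.mem_image_of_mem e (Finset.mem_coe.2 hκ)) (hgen κ hκ) hN φ
      rw [cornerDim_add_submoduleOf k hf (smul_mono_right _ hN), cornerDim_congr k ψ,
        Finset.sum_eq_single_of_mem κ hκ fun κ' hκ' hne => by
          rw [hzero κ hκ κ' hκ' hne.symm, zero_mul], hone κ hκ, one_mul]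
    · have hle := set_smul_le_of_factor_equiv (hker κ hκ) φ
      rw [set_smul_eq_of_set_smul_le hS hN hle, left_eq_add]
      refine Finset.sum_eq_zero fun κ' hκ' => ?_
      rw [(cornerDim_quotient_eq_zero_iff (hidem κ') _).2 fun x => hker κ hκ
        (mem_set_smul_of_mem_mem (Set.mem_image_of_mem e hκ') mem_top), zero_mul]

end Trace

section Orders

variable {Λ : Type*}

theorem exists_linearOrder_isBot (r : Λ → Λ → Prop) [IsPartialOrder Λ r] (ν : Λ) :
    ∃ L : LinearOrder Λ, (∀ a, L.le ν a) ∧ ∀ a b, b ≠ ν → r a b → L.le a b := by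
  have : IsPartialOrder Λ fun a b => a = ν ∨ b ≠ ν ∧ r a b :=
    { refl := fun a => or_iff_not_imp_left.2 fun h => ⟨h, refl_of r a⟩
      trans := by
        rintro a b c (rfl | ⟨hb, hab⟩) (rfl | ⟨hc, hbc⟩)
        · exact .inl rfl
        · exact .inl rfl
        · exact absurd rfl hb
        · exact .inr ⟨hc, trans_of r hab hbc⟩
      antisymm := by
        rintro a b (rfl | ⟨hb, hab⟩) (rfl | ⟨ha, hba⟩)
        · rfl
        · exact absurd rfl ha
        · exact absurd rfl hb
        · exact antisymm_of r hab hba }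
  obtain ⟨s, hs, hrs⟩ := extend_partialOrder fun a b => a = ν ∨ b ≠ ν ∧ r a b
  exact ⟨{ le := s
           le_refl := hs.refl
           le_trans := hs.trans
           le_antisymm := hs.antisymm
           le_total := hs.total
           toDecidableLE := Classical.decRel _ },
    fun a => hrs _ _ (.inl rfl), fun a b hb hab => hrs _ _ (.inr ⟨hb, hab⟩)⟩

theorem exists_linearOrder_isTop (ν : Λ) : ∃ L : LinearOrder Λ, ∀ a, L.le a ν := by
  have : IsPartialOrder Λ (· = ·) := { antisymm := fun _ _ h _ => h }
  obtain ⟨L, hL, -⟩ := exists_linearOrder_isBot (· = ·) ν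
  exact ⟨inferInstanceAs (LinearOrder Λᵒᵈ), hL⟩

end Orders

section OffDiag

variable {A : Type*} [Ring A] {Λ : Type*} {e : Λ → A}

/-- No product of two morphisms of the associated category leads from an object to a different one
and back: a consequence of directedness that is symmetric under passing to the opposite algebra. -/
def NoReturn (e : Λ → A) : Prop :=
  ∀ l m, m ≠ l → ∀ a b : A, e l * (a * (e m * (b * e l))) = 0

theorem NoReturn.op (h : NoReturn e) : NoReturn fun l => op (e l) := fun l m hml a b => by
  rw [← unop_inj]
  simpa only [unop_mul, unop_op, unop_zero, mul_assoc] using h l m hml (unop b) (unop a)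

theorem NoReturn.smul_eq_zero (h : NoReturn e) (hidem : ∀ l, IsIdempotentElem (e l)) {l : Λ}
    {T : Set Λ} (hl : l ∉ T) {p : ↥(ProjMod e l)}
    (hp : p ∈ (e '' T) • (⊤ : Submodule A ↥(ProjMod e l))) : e l • p = 0 := by
  refine (AddSubgroup.mem_bot (G := ↥(ProjMod e l))).1 (smul_mem_of_mem_set_smul ?_ hp)
  rintro a _ ⟨t, ht, rfl⟩ n -
  refine (AddSubgroup.mem_bot).2 (Subtype.ext ?_)
  change e l * (a * (e t * (n : A))) = 0
  rw [← (mem_span_idem (hidem l)).1 n.2]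
  exact h l t (ne_of_mem_of_not_mem ht hl) a n

/-- The submodule `⨁_{m ≠ l} e_m A e_l` of `P_l`, when no morphisms return to `e_l`. -/
abbrev offDiagPart (e : Λ → A) (l : Λ) : Submodule A ↥(ProjMod e l) := (e '' {l}ᶜ) • ⊤

variable [Fintype Λ]

theorem mem_offDiagPart_iff (he : CompleteOrthogonalIdempotents e) (hnr : NoReturn e) {l : Λ}
    {p : ↥(ProjMod e l)} : p ∈ offDiagPart e l ↔ e l • p = 0 := by
  refine ⟨hnr.smul_eq_zero he.idem (by simp), fun hp => ?_⟩
  rw [← one_smul A p, ← he.complete, Finset.sum_smul]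
  refine sum_mem fun m _ => ?_
  obtain rfl | hm := eq_or_ne m l
  · rw [hp]
    exact zero_mem _
  · exact mem_set_smul_of_mem_mem (Set.mem_image_of_mem e hm) mem_top

theorem mem_offDiag_iff (k : Type*) [Field k] [Algebra k A]
    (he : CompleteOrthogonalIdempotents e) {x : A} :
    x ∈ offDiag k e ↔ ∀ l, e l * x * e l = 0 := by
  classical
  constructor
  · intro hx n
    suffices offDiag k e ≤
        LinearMap.ker (LinearMap.mulLeft k (e n) ∘ₗ LinearMap.mulRight k (e n)) by
      simpa only [LinearMap.mem_ker, LinearMap.comp_apply, LinearMap.mulLeft_apply,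
        LinearMap.mulRight_apply, mul_assoc] using this hx
    refine offDiag_le fun l m hlm y hy => ?_
    rw [LinearMap.mem_ker, LinearMap.comp_apply, LinearMap.mulLeft_apply,
      LinearMap.mulRight_apply, ← mul_e_of_mem k he hy, ← e_mul_of_mem k he hy]
    obtain rfl | hn := eq_or_ne n m
    · rw [mul_assoc (e n * y), he.mul_eq, if_neg hlm, mul_zero, mul_zero]
    · rw [← mul_assoc, mul_assoc (e m), ← mul_assoc, he.mul_eq, if_neg hn, zero_mul, zero_mul]
  · intro hx
    rw [← one_mul x, ← mul_one (1 * x), ← he.complete, Finset.sum_mul, Finset.sum_mul_sum]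
    refine sum_mem fun m _ => sum_mem fun l _ => ?_
    obtain rfl | hlm := eq_or_ne l m
    · rw [hx]
      exact zero_mem _
    · exact peirce_le_offDiag hlm ((mem_peirce k).2 ⟨x, (mul_assoc _ _ _).symm⟩)

variable (he : CompleteOrthogonalIdempotents e) (hnr : NoReturn e) {J : Submodule A A}
  (hJ : ∀ x, x ∈ J ↔ ∀ l, e l * x * e l = 0)

include he hnr hJ

theorem offDiagPart_le_comap (l : Λ) : offDiagPart e l ≤ J.comap (ProjMod e l).subtype :=
  fun p hp => (hJ _).2 fun n => by
    classical
    have hpl : (p : A) * e l = p := (mem_span_idem (he.idem l)).1 p.2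
    obtain rfl | hn := eq_or_ne n l
    · rw [mul_assoc, subtype_apply, hpl]
      exact congrArg Subtype.val ((mem_offDiagPart_iff he hnr).1 hp)
    · rw [mul_assoc, subtype_apply, ← hpl, mul_assoc, he.mul_eq, if_neg hn.symm, mul_zero, mul_zero]

/-- Multiplication by the idempotents decomposes `J` into the modules `offDiagPart e l`. -/
theorem projective_iff_forall_offDiagPart :
    Module.Projective A ↥J ↔ ∀ l, Module.Projective A ↥(offDiagPart e l) := by
  classical
  let incl (l : Λ) : ↥(offDiagPart e l) →ₗ[A] ↥J :=
    (ProjMod e l).subtype.restrict (offDiagPart_le_comap he hnr hJ l)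
  let proj (l : Λ) : ↥J →ₗ[A] ↥(offDiagPart e l) :=
    ((LinearMap.toSpanSingleton A _ (gen (e l))).domRestrict J).codRestrict _ fun x =>
      (mem_offDiagPart_iff he hnr).2 <| Subtype.ext <|
        (mul_assoc _ _ _).symm.trans ((hJ x).1 x.2 l)
  constructor
  · intro _ l
    refine .of_split (incl l) (proj l) (LinearMap.ext fun p => Subtype.ext ?_)
    exact smul_gen (he.idem l) p.1
  · intro _
    have : Module.Projective A (∀ l, ↥(offDiagPart e l)) :=
      .of_equiv DFinsupp.linearEquivFunOnFintype
    refine .of_split (LinearMap.pi proj) (∑ l, incl l ∘ₗ .proj l)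
      (LinearMap.ext fun x => Subtype.ext ?_)
    calc (((∑ l, incl l ∘ₗ .proj l) ∘ₗ LinearMap.pi proj) x : A)
        = ((∑ l, incl l (proj l x) : ↥J) : A) := by
          rw [LinearMap.comp_apply, LinearMap.sum_apply]
          rfl
      _ = ∑ l, (x : A) * e l := AddSubmonoidClass.coe_finsetSum _ _
      _ = x := by rw [← Finset.mul_sum, he.complete, mul_one]

end OffDiag

section Directed

variable {A : Type*} [Ring A] {Λ : Type*} {e : Λ → A} {r : Λ → Λ → Prop}

/-- The associated category of `e` is directed by the relation `r`. -/
def IsDirectedBy (e : Λ → A) (r : Λ → Λ → Prop) : Prop :=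
  ∀ l m a, e m * (a * e l) ≠ 0 → r l m

theorem isDirectedCategory_iff (k : Type*) [Field k] [Algebra k A] [Fintype Λ]
    (he : CompleteOrthogonalIdempotents e) :
    IsDirectedCategory (AssocCat k he) ↔ ∃ r, IsPartialOrder Λ r ∧ IsDirectedBy e r := by
  constructor
  · rintro ⟨r, hr, h⟩
    refine ⟨fun l m => r ⟨l⟩ ⟨m⟩, { refl := fun a => hr.refl _
                                    trans := fun a b c => hr.trans _ _ _
                                    antisymm := fun a b hab hba =>
                                      congrArg AssocCat.idx (hr.antisymm _ _ hab hba) }, ?_⟩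
    exact fun l m a hne => h ⟨l⟩ ⟨m⟩ ⟨_, (mem_peirce k).2 ⟨a, rfl⟩⟩
      fun h0 => hne (congrArg Subtype.val h0)
  · rintro ⟨r, hr, h⟩
    refine ⟨fun X Y => r X.idx Y.idx, { refl := fun a => hr.refl _
                                        trans := fun a b c => hr.trans _ _ _
                                        antisymm := fun a b hab hba =>
                                          AssocCat.ext (hr.antisymm _ _ hab hba) }, ?_⟩
    rintro X Y ⟨x, hx⟩ hne
    obtain ⟨a, rfl⟩ := (mem_peirce k).1 hx
    exact h _ _ a fun h0 => hne (Subtype.ext h0)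

theorem IsDirectedBy.noReturn [IsPartialOrder Λ r] (hre : IsDirectedBy e r)
    (hidem : ∀ l, IsIdempotentElem (e l)) : NoReturn e := fun l m hml a b => by
  by_contra hne
  have hlm : r l m := hre l m b fun h => hne (by rw [h, mul_zero, mul_zero])
  have hml' : r m l := hre m l a fun h => hne (by
    rw [← (hidem m).eq, mul_assoc (e m), ← mul_assoc a, ← mul_assoc (e l), h, zero_mul])
  exact hml (antisymm_of r hml' hlm)

end Directed

section Retract

variable {A M M' : Type*} [Ring A] [AddCommGroup M] [Module A M] [AddCommGroup M'] [Module A M']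

theorem projective_set_smul_top_of_retract {S : Set A} (φ : M' →ₗ[A] M) (ψ : M →ₗ[A] M')
    (h : ψ ∘ₗ φ = LinearMap.id) [Module.Projective A ↥(S • (⊤ : Submodule A M))] :
    Module.Projective A ↥(S • (⊤ : Submodule A M')) :=
  .of_split (φ.restrict fun _ => map_mem_set_smul_top φ)
    (ψ.restrict fun _ => map_mem_set_smul_top ψ)
    (LinearMap.ext fun x => Subtype.ext (LinearMap.congr_fun h x))

theorem projective_set_smul_top_span {S : Set A} {f : A} (hf : IsIdempotentElem f)
    [Module.Projective A ↥(S • (⊤ : Submodule A A))] :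
    Module.Projective A ↥(S • (⊤ : Submodule A ↥(span A {f}))) :=
  projective_set_smul_top_of_retract (span A {f}).subtype
    (LinearMap.toSpanSingleton A _ (gen f)) (LinearMap.ext (smul_gen hf))

end Retract

section ForwardLeft

variable (k : Type*) [Field k] [IsAlgClosed k] {A : Type*} [Ring A] [Algebra k A]
  [FiniteDimensional k A] {Λ : Type*} {e : Λ → A}

include k

theorem exists_injective_of_mul_ne_zero (hprim : ∀ l, IsPrimitiveIdempotent (e l))
    (H : ∀ _ : LinearOrder Λ, HasFiltrationBy A A (StandardMod e)) {l m : Λ} {a : A}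
    (ha : e m * (a * e l) ≠ 0) :
    ∃ φ : ↥(ProjMod e m) →ₗ[A] ↥(ProjMod e l), Function.Injective φ := by
  have := IsArtinianRing.of_finite k A
  obtain ⟨L, hL⟩ := exists_linearOrder_isTop m
  have hIoi : Set.Ioi m = ∅ := Set.eq_empty_of_forall_notMem fun κ => (hL κ).not_gt
  have : Module.Projective A ↥((e '' {m}) • (⊤ : Submodule A A)) := by
    refine projective_set_smul_top (fun l => (hprim l).1) (H L) (fun κ hκ => ?_) ?_
    · rw [standardKer_eq k hprim]
      exact set_smul_mono_left ⊤ (Set.image_mono (Set.singleton_subset_iff.2 ((hL κ).lt_of_ne hκ)))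
    · rintro _ rfl
      rw [standardKer_eq k hprim, hIoi, Set.image_empty, empty_set_smul]
  let N := (e '' {m}) • (⊤ : Submodule A ↥(ProjMod e l))
  have : Module.Projective A ↥N := projective_set_smul_top_span (hprim l).1
  have : Nontrivial ↥N :=
    ⟨⟨e m • a • gen (e l), mem_set_smul_of_mem_mem ⟨m, rfl, rfl⟩ mem_top⟩, 0, fun h =>
      ha (congrArg (fun x : ↥N => ((x : ↥(ProjMod e l)) : A)) h)⟩
  have hN : (e '' {m}) • (⊤ : Submodule A ↥N) = ⊤ := by
    refine map_injective_of_injective N.injective_subtype ?_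
    rw [map_subtype_set_smul_top, map_subtype_top, set_smul_set_smul_of_isIdempotentElem]
    exact Set.forall_mem_image.2 fun t _ => (hprim t).1
  obtain ⟨_, ⟨_, rfl, rfl⟩, φ, σ, hφσ⟩ :=
    exists_split_surjection (Set.forall_mem_image.2 fun t _ => hprim t) hN
  exact ⟨N.subtype ∘ₗ σ, N.injective_subtype.comp
    (Function.LeftInverse.injective (LinearMap.congr_fun hφσ))⟩

theorem isDirectedBy_of_hasFiltrationBy (hprim : ∀ l, IsPrimitiveIdempotent (e l))
    (hbasic : IsBasic e) (H : ∀ _ : LinearOrder Λ, HasFiltrationBy A A (StandardMod e)) :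
    ∃ r, IsPartialOrder Λ r ∧ IsDirectedBy e r := by
  refine ⟨fun l m => ∃ φ : ↥(ProjMod e m) →ₗ[A] ↥(ProjMod e l), Function.Injective φ,
    { refl := fun l => ⟨LinearMap.id, Function.injective_id⟩
      trans := fun l m n ⟨φ, hφ⟩ ⟨ψ, hψ⟩ => ⟨φ ∘ₗ ψ, hφ.comp hψ⟩
      antisymm := ?_ }, fun l m a => exists_injective_of_mul_ne_zero k hprim H⟩
  rintro l m ⟨φ, hφ⟩ ⟨ψ, hψ⟩
  by_contra hne
  have hsurj : Function.Surjective (φ.restrictScalars k) :=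
    (LinearMap.injective_iff_surjective_of_finrank_eq_finrank (le_antisymm
      (LinearMap.finrank_le_finrank_of_injective (f := φ.restrictScalars k) hφ)
      (LinearMap.finrank_le_finrank_of_injective (f := ψ.restrictScalars k) hψ))).1 hφ
  exact (hbasic m l (Ne.symm hne)).false (.ofBijective φ ⟨hφ, hsurj⟩)

theorem projective_offDiagPart (hprim : ∀ l, IsPrimitiveIdempotent (e l))
    {r : Λ → Λ → Prop} [IsPartialOrder Λ r] (hre : IsDirectedBy e r)
    (H : ∀ _ : LinearOrder Λ, HasFiltrationBy A A (StandardMod e)) (ν : Λ) :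
    Module.Projective A ↥(offDiagPart e ν) := by
  obtain ⟨L, hbot, hL⟩ := exists_linearOrder_isBot (Function.swap r) ν
  suffices Module.Projective A ↥((e '' {ν}ᶜ) • (⊤ : Submodule A A)) from
    projective_set_smul_top_span (hprim ν).1
  refine projective_set_smul_top (fun l => (hprim l).1) (H L) (fun κ hκ => ?_) fun κ hκ => ?_
  · rw [standardKer_eq k hprim, Set.notMem_compl_iff.1 hκ]
    exact set_smul_mono_left ⊤ (Set.image_mono fun t ht => (hbot t).lt_of_ne (Ne.symm ht))
  · rw [standardKer_eq k hprim, eq_bot_iff, set_smul_le_iff]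
    rintro _ p ⟨t, ht, rfl⟩ -
    rw [mem_bot]
    by_contra hne
    have hr : r κ t := hre κ t p fun h => hne (Subtype.ext (by
      rwa [(mem_span_idem (hprim κ).1).1 p.2] at h))
    exact (hL t κ hκ hr).not_gt ht

end ForwardLeft

section Generators

variable (k : Type*) [Field k] {A M : Type*} [Ring A] [Algebra k A]
  [AddCommGroup M] [Module A M] [Module k M] [IsScalarTower k A M] [FiniteDimensional k M]

/-- The generators define a surjection from the sum of the projective modules `A f i`, which is
bijective by comparison of dimensions. -/
theorem projective_span_of_finrank_eq [FiniteDimensional k A] {ι : Type*} [Fintype ι] {f : ι → A}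
    {x : ι → M} (hf : ∀ i, IsIdempotentElem (f i)) (hfx : ∀ i, f i • x i = x i)
    (hdim : ∑ i, Module.finrank k ↥(span A {f i}) = Module.finrank k ↥(span A (Set.range x))) :
    Module.Projective A ↥(span A (Set.range x)) := by
  classical
  let Φ : (∀ i, ↥(span A {f i})) →ₗ[A] M := ∑ i, evalAt (f i) (x i) ∘ₗ .proj i
  have hΦ (q) : Φ q = ∑ i, (q i : A) • x i := LinearMap.sum_apply _ _ _
  have hrange : LinearMap.range Φ = span A (Set.range x) := by
    refine le_antisymm ?_ (span_le.2 ?_)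
    · rintro _ ⟨q, rfl⟩
      rw [hΦ]
      exact sum_mem fun i _ => smul_mem _ _ (subset_span ⟨i, rfl⟩)
    · rintro _ ⟨i, rfl⟩
      refine ⟨Pi.single i (gen (f i)), ?_⟩
      rw [hΦ, Finset.sum_eq_single i (fun j _ hj => by
        rw [Pi.single_eq_of_ne hj, coe_zero, zero_smul]) (by simp), Pi.single_eq_same]
      exact hfx i
  rw [← hrange] at hdim ⊢
  have := fun i => projective_span_idem (hf i)
  have : Module.Projective A (∀ i, ↥(span A {f i})) := .of_equiv DFinsupp.linearEquivFunOnFintype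
  refine .of_equiv (LinearEquiv.ofBijective Φ.rangeRestrict ⟨?_, Φ.surjective_rangeRestrict⟩)
  exact (LinearMap.injective_iff_surjective_of_finrank_eq_finrank
    ((Module.finrank_pi_fintype k).trans hdim)
    (f := Φ.rangeRestrict.restrictScalars k)).2 Φ.surjective_rangeRestrict

theorem sum_cornerDim {Λ : Type*} [Fintype Λ] {e : Λ → A} (he : CompleteOrthogonalIdempotents e) :
    ∑ l, cornerDim k M (e l) = Module.finrank k M := by
  classical
  let φ : M ≃ₗ[k] ∀ l, ↥(fixedBy k M (e l)) :=
    { toFun := fun x l => ⟨e l • x, by rw [mem_fixedBy, ← mul_smul, (he.idem l).eq]⟩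
      map_add' := fun x y => funext fun l => Subtype.ext (smul_add _ _ _)
      map_smul' := fun c x => funext fun l => Subtype.ext (smul_algebra_smul_comm c _ x)
      invFun := fun q => ∑ l, (q l : M)
      left_inv := fun x => Finset.sum_smul.symm.trans (by rw [he.complete, one_smul])
      right_inv := fun q => funext fun l => Subtype.ext <| by
        have hq (m) : e l • (q m : M) = if l = m then (q m : M) else 0 := by
          rw [← (mem_fixedBy k).1 (q m).2, ← mul_smul, he.mul_eq, ite_smul, zero_smul]
          split_ifs with h <;> simp only [h]
        change e l • ∑ m, (q m : M) = q l
        rw [Finset.smul_sum, Finset.sum_congr rfl fun m _ => hq m, Finset.sum_ite_eq,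
          if_pos (Finset.mem_univ l)] }
  rw [φ.finrank_eq, Module.finrank_pi_fintype]
  rfl

theorem exists_generators_fixedBy {f : A} (hf : IsIdempotentElem f) (N : Submodule A M) :
    ∃ g : Fin (cornerDim k (M ⧸ N) f) → M, (∀ i, f • g i = g i) ∧
      fixedBy k M f ≤ span k (Set.range g) ⊔ N.restrictScalars k ⊓ fixedBy k M f := by
  let b := Module.finBasis k ↥(fixedBy k (M ⧸ N) f)
  have hb (i) : ∃ x ∈ fixedBy k M f, N.mkQ x = b i := (map_mkQ_fixedBy k hf N).ge (b i).2
  choose g hg hgb using hb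
  let π : M →ₗ[k] M ⧸ N := N.mkQ.restrictScalars k
  have hmap : (span k (Set.range g)).map π = fixedBy k (M ⧸ N) f := by
    have hrange : π ∘ g = (fixedBy k (M ⧸ N) f).subtype ∘ b := funext hgb
    rw [map_span, ← Set.range_comp, hrange, Set.range_comp, ← map_span, b.span_eq, map_subtype_top]
  have hker : LinearMap.ker π = N.restrictScalars k :=
    SetLike.ext fun x => LinearMap.mem_ker.trans (Quotient.mk_eq_zero N)
  refine ⟨g, hg, ?_⟩
  calc fixedBy k M f
      ≤ (span k (Set.range g) ⊔ N.restrictScalars k) ⊓ fixedBy k M f := by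
        refine le_inf ?_ le_rfl
        rw [← hker, ← comap_map_eq, hmap, ← map_mkQ_fixedBy k hf]
        exact le_comap_map π _
    _ = _ := sup_inf_assoc_of_le _ (span_le.2 (Set.range_subset_iff.2 hg))

end Generators

section Nilpotence

variable {k : Type*} [Field k] {A : Type*} [Ring A] [Algebra k A]

theorem le_of_le_sup_mul {J R N : Submodule k A} (hJ : J ≤ R ⊔ J * N) (hR : R * N ≤ R)
    (hN : IsNilpotent N) : J ≤ R := by
  obtain ⟨n, hn⟩ := hN
  have h (i : ℕ) : J ≤ R ⊔ J * N ^ i := by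
    induction i with
    | zero => rw [pow_zero, mul_one]; exact le_sup_right
    | succ i ih =>
      refine hJ.trans (sup_le le_sup_left ((mul_le_mul_left ih N).trans ?_))
      rw [Submodule.sup_mul, mul_assoc, ← pow_succ]
      exact sup_le_sup_right hR _
  have := h n
  rwa [hn, zero_eq_bot, Submodule.mul_bot, sup_bot_eq] at this

theorem isNilpotent_restrictScalars_jacobson [FiniteDimensional k A] :
    IsNilpotent ((Ring.jacobson A).restrictScalars k) := by
  have := IsArtinianRing.of_finite k A
  obtain ⟨n, hn⟩ := IsSemiprimaryRing.isNilpotent (R := A)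
  refine ⟨n + 1, ?_⟩
  rw [← restrictScalars_pow n.succ_ne_zero, Submodule.pow_succ, hn, zero_eq_bot,
    Submodule.bot_mul, restrictScalars_bot, zero_eq_bot]

variable (k)

theorem finrank_span_op {f : A} (hf : IsIdempotentElem f) :
    Module.finrank k ↥(span Aᵐᵒᵖ {op f}) = cornerDim k A f := by
  refine ((opLinearEquiv k : A ≃ₗ[k] Aᵐᵒᵖ).ofSubmodules (fixedBy k A f)
    ((span Aᵐᵒᵖ {op f}).restrictScalars k) ?_).finrank_eq.symm
  ext x
  have hop : IsIdempotentElem (op f) := by rw [IsIdempotentElem, ← op_mul, hf.eq]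
  rw [restrictScalars_mem, mem_span_idem hop, mem_map_equiv, ← unop_inj]
  rfl

end Nilpotence

section ProperStandardCount

variable (k : Type*) [Field k] {A : Type*} [Ring A] [Algebra k A] [FiniteDimensional k A]
  {Λ : Type*} {e : Λ → A}

theorem mul_mem_offDiag_mul_jacobson [Finite Λ]
    (hprim : ∀ l, IsPrimitiveIdempotent (e l))
    (hbasic : IsBasic e) {T : Set Λ} {κ ν : Λ} (hκT : κ ∉ T) (hνT : ν ∉ T) (hκν : κ ≠ ν)
    {z : ↥(ProjMod e κ)}
    (hz : z ∈ (e '' T ∪ nilCorner (e κ)) • (⊤ : Submodule A ↥(ProjMod e κ))) :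
    e ν * (z : A) ∈ offDiag k e * (Ring.jacobson A).restrictScalars k := by
  have := IsArtinianRing.of_finite k A
  have := Fintype.ofFinite Λ
  let V : Submodule k ↥(ProjMod e κ) :=
    (offDiag k e * (Ring.jacobson A).restrictScalars k).comap
      ((ProjMod e κ).subtype.restrictScalars k)
  refine smul_mem_of_mem_set_smul (V := V.toAddSubgroup) (fun a s hs n _ => ?_) hz
  have hsn : s • n ∈ Module.jacobson A ↥(ProjMod e κ) :=
    set_smul_top_le_jacobson hprim hbasic hκT (mem_set_smul_of_mem_mem hs mem_top)
  obtain ⟨t, htν, hts⟩ : ∃ t, t ≠ ν ∧ e t * s = s := by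
    obtain ⟨t, ht, rfl⟩ | hs := hs
    · exact ⟨t, ne_of_mem_of_not_mem ht hνT, (hprim t).1⟩
    · exact ⟨κ, hκν, hs.1⟩
  have hmul : e ν * (a * (s * (n : A))) = e ν * (a * e t) * (s * n) := by
    rw [mul_assoc, mul_assoc a, ← mul_assoc (e t), hts]
  change e ν * (a * (s * (n : A))) ∈ offDiag k e * (Ring.jacobson A).restrictScalars k
  rw [hmul]
  exact mul_mem_mul (peirce_le_offDiag htν ((mem_peirce k).2 ⟨a, rfl⟩))
    (Module.le_comap_jacobson (ProjMod e κ).subtype hsn)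

variable [Fintype Λ]

theorem mem_set_smul_compl_iff (he : CompleteOrthogonalIdempotents e) (hnr : NoReturn e) {ν : Λ}
    {x : A} (hx : e ν * x = x) :
    x ∈ (e '' {ν}ᶜ) • (⊤ : Submodule A A) ↔ ∀ l, e l * x * e l = 0 := by
  classical
  constructor
  · intro h l
    obtain rfl | hl := eq_or_ne l ν
    · have hp := map_mem_set_smul_top (LinearMap.toSpanSingleton A _ (gen (e l))) h
      exact (mul_assoc _ _ _).trans (congrArg Subtype.val ((mem_offDiagPart_iff he hnr).1 hp))
    · rw [← hx, ← mul_assoc, he.mul_eq, if_neg hl, zero_mul, zero_mul]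
  · intro h
    rw [← mul_one x, ← he.complete, Finset.mul_sum]
    refine sum_mem fun m _ => ?_
    obtain rfl | hm := eq_or_ne m ν
    · rw [← hx, h]
      exact zero_mem _
    · exact smul_mem _ x (by
        simpa only [smul_eq_mul, mul_one] using
          mem_set_smul_of_mem_mem (Set.mem_image_of_mem e hm) (mem_top (x := (1 : A))))

theorem exists_generators_peirce (he : CompleteOrthogonalIdempotents e)
    (hprim : ∀ l, IsPrimitiveIdempotent (e l)) (hbasic : IsBasic e) {T : Set Λ} {κ ν : Λ}
    (hκT : κ ∉ T) (hνT : ν ∉ T) (hκν : κ ≠ ν) :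
    ∃ g : Fin (cornerDim k (↥(ProjMod e κ) ⧸
        (e '' T ∪ nilCorner (e κ)) • (⊤ : Submodule A ↥(ProjMod e κ))) (e ν)) → A,
      (∀ i, g i ∈ peirce k e κ ν) ∧ peirce k e κ ν ≤
        span k (Set.range g) ⊔ offDiag k e * (Ring.jacobson A).restrictScalars k := by
  have hmem (z) : z ∈ ProjMod e κ ↔ z * e κ = z := mem_span_idem (he.idem κ)
  obtain ⟨g, hg, hspan⟩ := exists_generators_fixedBy k (he.idem ν)
    ((e '' T ∪ nilCorner (e κ)) • (⊤ : Submodule A ↥(ProjMod e κ)))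
  refine ⟨fun i => g i, fun i => (mem_peirce k).2 ⟨g i, ?_⟩, fun y hy => ?_⟩
  · rw [(hmem _).1 (g i).2]
    exact congrArg Subtype.val (hg i)
  · obtain ⟨u, hu, z, ⟨hzK, hzν⟩, huz⟩ := mem_sup.1 (hspan (x := ⟨y, (hmem y).2
      (mul_e_of_mem k he hy)⟩) (Subtype.ext (e_mul_of_mem k he hy)))
    have hz : (z : A) ∈ offDiag k e * (Ring.jacobson A).restrictScalars k := by
      rw [← congrArg Subtype.val hzν]
      exact mul_mem_offDiag_mul_jacobson k hprim hbasic hκT hνT hκν hzK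
    refine mem_sup.2 ⟨u, ?_, z, hz, congrArg Subtype.val huz⟩
    have := mem_map_of_mem (f := (ProjMod e κ).subtype.restrictScalars k) hu
    rwa [map_span, ← Set.range_comp] at this

variable [IsAlgClosed k] {r : Λ → Λ → Prop} [DecidableEq Λ]

theorem cornerDim_eq_sum_properStandardMod [LinearOrder Λ]
    (he : CompleteOrthogonalIdempotents e) (hnr : NoReturn e) (hre : IsDirectedBy e r)
    (hprim : ∀ l, IsPrimitiveIdempotent (e l)) (hbasic : IsBasic e) {ν : Λ}
    (hbot : ∀ l, ν ≤ l) (hle : ∀ l m, m ≠ ν → r l m → l ≤ m)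
    (hF : HasFiltrationBy A A (ProperStandardMod e)) {J : Submodule A A}
    (hJ : ∀ x, x ∈ J ↔ ∀ l, e l * x * e l = 0) :
    cornerDim k ↥J (e ν) = ∑ κ ∈ Finset.univ.erase ν,
      cornerDim k A (e κ) * cornerDim k (ProperStandardMod e κ) (e ν) := by
  have hK := properStandardKer_eq k hprim hbasic
  have hIoi {κ t : Λ} (h : κ < t) (p : ↥(ProjMod e κ)) : e t • p ∈ properStandardKer e κ := by
    rw [hK]
    exact mem_set_smul_of_mem_mem (.inl (Set.mem_image_of_mem e h)) mem_top
  have hT : ((Finset.univ.erase ν : Finset Λ) : Set Λ) = {ν}ᶜ := by ext; simp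
  have hcompl {t : Λ} : t ≠ ν ↔ ν < t := (hbot t).lt_iff_ne'.symm
  rw [← cornerDim_set_smul_top_eq_sum (K := properStandardKer e) k he.idem hF ?_ ?_ ?_ ?_
    (he.idem ν), hT, cornerDim_submodule, cornerDim_submodule]
  · refine congrArg (fun V : Submodule k A => Module.finrank k ↥V) (SetLike.ext fun x => ?_)
    exact and_congr_right fun hx => (hJ x).trans (mem_set_smul_compl_iff he hnr hx).symm
  · intro κ hκ
    obtain rfl : κ = ν := by simpa using hκ
    rw [hT]
    refine set_smul_le _ _ _ ?_
    rintro _ p ⟨t, ht, rfl⟩ -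
    exact hIoi (hcompl.1 ht) p
  · intro κ hκ
    have hκν := Finset.ne_of_mem_erase hκ
    rw [hT, hK]
    refine le_set_smul_set_smul ?_ _
    rintro s (⟨t, ht, rfl⟩ | hs)
    · exact ⟨e t, Set.mem_image_of_mem e (hcompl.2 ((hbot κ).trans_lt ht)), he.idem t⟩
    · exact ⟨e κ, Set.mem_image_of_mem e hκν, hs.1⟩
  · intro κ _
    rw [hK, cornerDim_quotient_set_smul_self k hprim hbasic Set.self_notMem_Ioi]
  · intro κ _ t ht hne
    refine (cornerDim_quotient_eq_zero_iff (he.idem t) _).2 fun p => ?_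
    obtain hlt | hlt := hne.lt_or_gt
    · exact hIoi hlt p
    · by_contra hp
      refine (hle κ t (Finset.ne_of_mem_erase ht) (hre κ t p fun h => hp ?_)).not_gt hlt
      rw [(mem_span_idem (he.idem κ)).1 p.2] at h
      rw [show e t • p = 0 from Subtype.ext h]
      exact zero_mem _

end ProperStandardCount

section ForwardRight

variable (k : Type*) [Field k] [IsAlgClosed k] {A : Type*} [Ring A] [Algebra k A]
  [FiniteDimensional k A] {Λ : Type*} [Fintype Λ] {e : Λ → A}
  {r : Λ → Λ → Prop} [IsPartialOrder Λ r]

/-- Generators of the right module `e_ν J`, as few as the dimension count for a proper standard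
filtration allows. -/
theorem exists_generators [DecidableEq Λ] (he : CompleteOrthogonalIdempotents e)
    (hre : IsDirectedBy e r)
    (hprim : ∀ l, IsPrimitiveIdempotent (e l)) (hbasic : IsBasic e)
    (H : ∀ _ : LinearOrder Λ, HasFiltrationBy A A (ProperStandardMod e)) {J : Submodule A A}
    (hJ : ∀ x, x ∈ J ↔ ∀ l, e l * x * e l = 0) (ν : Λ) :
    ∃ c : {κ // κ ≠ ν} → ℕ, cornerDim k ↥J (e ν) = ∑ κ, c κ * cornerDim k A (e κ) ∧
      ∀ κ, ∃ g : Fin (c κ) → A, (∀ i, g i ∈ peirce k e κ ν) ∧ peirce k e κ ν ≤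
        span k (Set.range g) ⊔ offDiag k e * (Ring.jacobson A).restrictScalars k := by
  obtain ⟨L, hbot, hle⟩ := exists_linearOrder_isBot r ν
  refine ⟨fun κ => cornerDim k (ProperStandardMod e κ.1) (e ν), ?_, fun κ => ?_⟩
  · rw [cornerDim_eq_sum_properStandardMod k he (hre.noReturn he.idem) hre hprim hbasic hbot hle
      (H L) hJ, Finset.sum_subtype (p := (· ≠ ν)) _ (by simp)]
    exact Finset.sum_congr rfl fun κ _ => mul_comm _ _
  · have hgen := exists_generators_peirce k he hprim hbasic (T := Set.Ioi κ.1)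
      Set.self_notMem_Ioi (hbot κ).not_gt κ.2
    rwa [← properStandardKer_eq k hprim hbasic] at hgen

theorem projective_rightJ {he : CompleteOrthogonalIdempotents e} (hre : IsDirectedBy e r)
    (hprim : ∀ l, IsPrimitiveIdempotent (e l)) (hbasic : IsBasic e)
    (H : ∀ _ : LinearOrder Λ, HasFiltrationBy A A (ProperStandardMod e))
    (hd : IsDirectedCategory (AssocCat k he)) : Module.Projective Aᵐᵒᵖ ↥(rightJ hd) := by
  classical
  choose c hc g hg hspan using
    exists_generators (J := leftJ hd) k he hre hprim hbasic H fun x => mem_offDiag_iff k he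
  let x (i : Σ ν : Λ, Σ κ : {κ // κ ≠ ν}, Fin (c ν κ)) : A := g i.1 i.2.1 i.2.2
  have hxJ : rightJ hd = span Aᵐᵒᵖ (Set.range x) := by
    refine le_antisymm ?_ (span_le.2 ?_)
    · refine le_of_le_sup_mul (J := offDiag k e)
        (R := (span Aᵐᵒᵖ (Set.range x)).restrictScalars k) ?_ ?_
        isNilpotent_restrictScalars_jacobson
      · refine offDiag_le fun κ ν h => (hspan ν ⟨κ, h⟩).trans (sup_le_sup_right ?_ _)
        rw [span_le]
        rintro _ ⟨i, rfl⟩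
        exact subset_span ⟨⟨ν, ⟨κ, h⟩, i⟩, rfl⟩
      · exact mul_le.2 fun y hy a _ => smul_mem _ (op a) hy
    · rintro _ ⟨i, rfl⟩
      exact peirce_le_offDiag i.2.1.2 (hg i.1 i.2.1 i.2.2)
  rw [hxJ]
  refine projective_span_of_finrank_eq k (f := fun i => op (e i.2.1)) (fun i => ?_) (fun i => ?_) ?_
  · rw [IsIdempotentElem, ← op_mul, he.idem]
  · exact (mul_e_of_mem k he (hg i.1 i.2.1 i.2.2) :)
  · calc ∑ i : Σ ν : Λ, Σ κ : {κ // κ ≠ ν}, Fin (c ν κ),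
          Module.finrank k ↥(span Aᵐᵒᵖ {op (e i.2.1)})
        = ∑ ν, ∑ κ, c ν κ * cornerDim k A (e κ) := by
          simp only [finrank_span_op k (he.idem _), Fintype.sum_sigma, Finset.sum_const,
            Finset.card_univ, Fintype.card_fin, smul_eq_mul]
      _ = Module.finrank k ↥(leftJ hd) := by simp only [← hc, sum_cornerDim k he]
      _ = Module.finrank k ↥(rightJ hd) := rfl
      _ = _ := by rw [hxJ]

end ForwardRight

section Split

variable {A M M' : Type*} [Ring A] [AddCommGroup M] [Module A M] [AddCommGroup M'] [Module A M']
  {φ : M →ₗ[A] M'} {σ : M' →ₗ[A] M}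

/-- The projection of `M` onto the kernel of a surjection `φ` along the image of a section `σ`. -/
def kerRetraction (hσ : φ ∘ₗ σ = LinearMap.id) : M →ₗ[A] ↥(LinearMap.ker φ) :=
  (LinearMap.id - σ ∘ₗ φ).codRestrict _ fun x => by
    rw [LinearMap.mem_ker, LinearMap.sub_apply, map_sub, LinearMap.id_apply, sub_eq_zero]
    exact (LinearMap.congr_fun hσ (φ x)).symm

theorem kerRetraction_apply_of_mem (hσ : φ ∘ₗ σ = LinearMap.id) {x : M}
    (hx : x ∈ LinearMap.ker φ) : (kerRetraction hσ x : M) = x := by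
  change x - σ (φ x) = x
  rw [LinearMap.mem_ker.1 hx, map_zero, sub_zero]

theorem exists_set_smul_top_surjective (S : Set A) (hσ : φ ∘ₗ σ = LinearMap.id) :
    ∃ ψ : ↥(S • (⊤ : Submodule A M)) →ₗ[A] ↥(S • (⊤ : Submodule A M')), Function.Surjective ψ ∧
      Nonempty (↥(S • (⊤ : Submodule A ↥(LinearMap.ker φ))) ≃ₗ[A] ↥(LinearMap.ker ψ)) := by
  let ψ : ↥(S • (⊤ : Submodule A M)) →ₗ[A] ↥(S • (⊤ : Submodule A M')) :=
    φ.restrict fun _ hx => map_mem_set_smul_top φ hx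
  let incl : ↥(S • (⊤ : Submodule A ↥(LinearMap.ker φ))) →ₗ[A] ↥(S • (⊤ : Submodule A M)) :=
    (LinearMap.ker φ).subtype.restrict fun _ hx => map_mem_set_smul_top _ hx
  have hincl : Function.Injective incl := fun x y h =>
    Subtype.ext (Subtype.ext (congrArg (fun z : ↥(S • (⊤ : Submodule A M)) => (z : M)) h))
  have hrange : LinearMap.range incl = LinearMap.ker ψ := by
    refine le_antisymm ?_ fun x hx => ?_
    · rintro _ ⟨y, rfl⟩
      exact Subtype.ext y.1.2
    · exact ⟨⟨_, map_mem_set_smul_top (kerRetraction hσ) x.2⟩,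
        Subtype.ext (kerRetraction_apply_of_mem hσ (congrArg Subtype.val hx))⟩
  refine ⟨ψ, fun y => ⟨⟨σ y, map_mem_set_smul_top σ y.2⟩, Subtype.ext ?_⟩,
    ⟨(LinearEquiv.ofInjective incl hincl).trans (LinearEquiv.ofEq _ _ hrange)⟩⟩
  exact LinearMap.congr_fun hσ (y : M')

theorem projective_ker (hσ : φ ∘ₗ σ = LinearMap.id) [Module.Projective A M] :
    Module.Projective A ↥(LinearMap.ker φ) :=
  .of_split (LinearMap.ker φ).subtype (kerRetraction hσ)
    (LinearMap.ext fun x => Subtype.ext (kerRetraction_apply_of_mem hσ x.2))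

end Split

section Induction

variable {A : Type u} [Ring A] {Λ : Type*} {e : Λ → A}

theorem NoReturn.set_smul_top_ne_top (hnr : NoReturn e) (hprim : ∀ l, IsPrimitiveIdempotent (e l))
    {l : Λ} {T : Set Λ} (hl : l ∉ T) : (e '' T) • (⊤ : Submodule A ↥(ProjMod e l)) ≠ ⊤ := by
  intro h
  have hgen : e l • gen (e l) = 0 :=
    hnr.smul_eq_zero (fun m => (hprim m).1) hl (h.symm ▸ mem_top (x := gen (e l)))
  exact (hprim l).2.1 ((hprim l).1.eq.symm.trans (congrArg Subtype.val hgen))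

theorem set_smul_top_of_complete [Fintype Λ] {M : Type*} [AddCommGroup M] [Module A M]
    (he : CompleteOrthogonalIdempotents e) : (e '' Set.univ) • (⊤ : Submodule A M) = ⊤ := by
  refine eq_top_iff'.2 fun x => ?_
  rw [← one_smul A x, ← he.complete, Finset.sum_smul]
  exact sum_mem fun l _ =>
    mem_set_smul_of_mem_mem (Set.mem_image_of_mem e (Set.mem_univ l)) mem_top

theorem set_smul_top_eq_set_smul_offDiagPart {S : Set A} {l : Λ}
    (hS : ∀ s ∈ S, ∃ m ≠ l, s * e m = s) :
    S • (⊤ : Submodule A ↥(ProjMod e l)) = S • offDiagPart e l := by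
  refine le_antisymm (set_smul_le S _ _ fun s x hs _ => ?_) (smul_mono_right S le_top)
  obtain ⟨m, hm, hsm⟩ := hS s hs
  rw [← hsm, mul_smul]
  exact mem_set_smul_of_mem_mem hs
    (mem_set_smul_of_mem_mem (Set.mem_image_of_mem e hm) mem_top)

variable (k : Type*) [Field k] [Algebra k A] [FiniteDimensional k A] [Fintype Λ]

/-- A nonzero projective module splits off some `P_l`, and `P_l` may be replaced by its smaller
projective submodule `offDiagPart e l`. -/
theorem projective_induction (he : CompleteOrthogonalIdempotents e)
    (hprim : ∀ l, IsPrimitiveIdempotent (e l)) (hnr : NoReturn e)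
    (hJ : ∀ l, Module.Projective A ↥(offDiagPart e l))
    (Q : ∀ (M : Type u) [AddCommGroup M] [Module A M] [Module k M] [IsScalarTower k A M]
      [FiniteDimensional k M], Prop)
    (subsingleton : ∀ (M : Type u) [AddCommGroup M] [Module A M] [Module k M]
      [IsScalarTower k A M] [FiniteDimensional k M] [Subsingleton M], Q M)
    (split : ∀ (M : Type u) [AddCommGroup M] [Module A M] [Module k M] [IsScalarTower k A M]
      [FiniteDimensional k M] (l : Λ) (φ : M →ₗ[A] ↥(ProjMod e l)) (σ : ↥(ProjMod e l) →ₗ[A] M),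
      φ ∘ₗ σ = LinearMap.id → Q ↥(LinearMap.ker φ) → Q ↥(ProjMod e l) → Q M)
    (projMod : ∀ l, Q ↥(offDiagPart e l) → Q ↥(ProjMod e l))
    (M : Type u) [AddCommGroup M] [Module A M] [Module k M] [IsScalarTower k A M]
    [FiniteDimensional k M] [Module.Projective A M] : Q M := by
  have := IsArtinianRing.of_finite k A
  suffices H : ∀ (n : ℕ) (M : Type u) [AddCommGroup M] [Module A M] [Module k M]
      [IsScalarTower k A M] [FiniteDimensional k M] [Module.Projective A M],
      Module.finrank k M = n → Q M from H _ M rfl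
  intro n
  induction n using Nat.strong_induction_on with | _ n ih
  intro M _ _ _ _ _ _ hn
  obtain hM | hM := subsingleton_or_nontrivial M
  · exact subsingleton M
  have := Module.Finite.of_restrictScalars_finite k A M
  obtain ⟨_, ⟨l, -, rfl⟩, φ, σ, hσ⟩ := exists_split_surjection
    (Set.forall_mem_image.2 fun l _ => hprim l) (set_smul_top_of_complete (M := M) he)
  have := projective_ker hσ
  have := hJ l
  have := nontrivial_span (hprim l)
  have hφ : Function.Surjective φ := fun p => ⟨σ p, LinearMap.congr_fun hσ p⟩
  have hdim : Module.finrank k ↥(ProjMod e l) + Module.finrank k ↥(LinearMap.ker φ) = n := by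
    rw [← hn, ← finrank_quotient_add k (LinearMap.ker φ),
      ((φ.quotKerEquivOfSurjective hφ).restrictScalars k).finrank_eq]
  have := Module.finrank_pos (R := k) (M := ↥(ProjMod e l))
  have hlt : Module.finrank k ↥(offDiagPart e l) < Module.finrank k ↥(ProjMod e l) :=
    finrank_lt (s := (offDiagPart e l).restrictScalars k)
      ((restrictScalars_eq_top_iff k A _).not.2 (hnr.set_smul_top_ne_top hprim (by simp)))
  exact split M l φ σ hσ (ih _ (by omega) _ rfl) (projMod l (ih _ (by omega) _ rfl))

include k in
theorem hasFiltrationBy_standardMod [IsAlgClosed k] [LinearOrder Λ]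
    (he : CompleteOrthogonalIdempotents e) (hprim : ∀ l, IsPrimitiveIdempotent (e l))
    (hnr : NoReturn e) (hJ : ∀ l, Module.Projective A ↥(offDiagPart e l)) :
    HasFiltrationBy A A (StandardMod e) := by
  suffices H : ∀ T : Set Λ, HasFiltrationBy A ↥((e '' T) • (⊤ : Submodule A A)) (StandardMod e) from
    ((H Set.univ).congr (.ofEq _ _ (set_smul_top_of_complete he))).congr topEquiv
  refine projective_induction k he hprim hnr hJ (fun M => ∀ T : Set Λ,
    HasFiltrationBy A ↥((e '' T) • (⊤ : Submodule A M)) (StandardMod e)) ?_ ?_ ?_ A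
  · exact fun M _ _ _ _ _ _ T => hasFiltrationBy_of_subsingleton
  · intro M _ _ _ _ _ l φ σ hσ hker hproj T
    obtain ⟨ψ, hψ, ⟨θ⟩⟩ := exists_set_smul_top_surjective (e '' T) hσ
    exact hasFiltrationBy_of_surjective hψ ((hker T).congr θ) (hproj T)
  · intro l hl T
    have of_notMem {T : Set Λ} (hlT : l ∉ T) : HasFiltrationBy A
        ↥((e '' T) • (⊤ : Submodule A ↥(ProjMod e l))) (StandardMod e) := by
      rw [set_smul_top_eq_set_smul_offDiagPart (e := e) (Set.forall_mem_image.2 fun t ht =>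
        ⟨t, ne_of_mem_of_not_mem ht hlT, (hprim t).1⟩)]
      exact (hl T).congr (setSMulTopEquiv _ _)
    by_cases hlT : l ∈ T
    · rw [set_smul_top_span_of_mem (hprim l).1 (Set.mem_image_of_mem e hlT)]
      refine (hasFiltrationBy_of_quotient (standardKer e l) ?_
        (hasFiltrationBy_of_equiv l (.refl A _))).congr topEquiv.symm
      rw [standardKer_eq k hprim]
      exact of_notMem (by simp)
    · exact of_notMem hlT

end Induction

section DimensionCount

variable (k : Type*) [Field k] {A : Type u} [Ring A] [Algebra k A] {Λ : Type*} {e : Λ → A}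

theorem cornerDim_quotient_set_smul_split {M M' : Type*} [AddCommGroup M] [Module A M]
    [Module k M] [IsScalarTower k A M] [FiniteDimensional k M] [AddCommGroup M'] [Module A M']
    [Module k M'] [IsScalarTower k A M'] [FiniteDimensional k M'] {f : A}
    (hf : IsIdempotentElem f) (S : Set A) {φ : M →ₗ[A] M'} {σ : M' →ₗ[A] M}
    (hσ : φ ∘ₗ σ = LinearMap.id) :
    cornerDim k (M ⧸ S • (⊤ : Submodule A M)) f =
      cornerDim k (↥(LinearMap.ker φ) ⧸ S • (⊤ : Submodule A ↥(LinearMap.ker φ))) f +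
        cornerDim k (M' ⧸ S • (⊤ : Submodule A M')) f := by
  obtain ⟨ψ, hψ, ⟨θ⟩⟩ := exists_set_smul_top_surjective S hσ
  have hφ : Function.Surjective φ := fun y => ⟨σ y, LinearMap.congr_fun hσ y⟩
  have hM := cornerDim_add k hf (LinearMap.ker φ)
  have hSM := cornerDim_add k hf (LinearMap.ker ψ)
  rw [cornerDim_congr k (φ.quotKerEquivOfSurjective hφ)] at hM
  rw [cornerDim_congr k (ψ.quotKerEquivOfSurjective hψ), ← cornerDim_congr k θ] at hSM
  have hquot := cornerDim_add k hf (S • (⊤ : Submodule A M))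
  have hquot' := cornerDim_add k hf (S • (⊤ : Submodule A M'))
  have hquot_ker := cornerDim_add k hf (S • (⊤ : Submodule A ↥(LinearMap.ker φ)))
  omega

variable [FiniteDimensional k A]

theorem NoReturn.cornerDim_quotient_set_smul_top (hnr : NoReturn e)
    (hidem : ∀ l, IsIdempotentElem (e l)) {l : Λ} {T : Set Λ} (hl : l ∉ T) :
    cornerDim k (↥(ProjMod e l) ⧸ (e '' T) • (⊤ : Submodule A ↥(ProjMod e l))) (e l) =
      cornerDim k ↥(ProjMod e l) (e l) := by
  rw [cornerDim_add k (hidem l) ((e '' T) • (⊤ : Submodule A ↥(ProjMod e l))),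
    (cornerDim_eq_zero_iff (hidem l)).2 fun p => Subtype.ext (hnr.smul_eq_zero hidem hl p.2),
    zero_add]

theorem cornerDim_quotient_set_smul_offDiagPart (hidem : ∀ l, IsIdempotentElem (e l)) {l m : Λ}
    (hml : m ≠ l) {S : Set A} (hS : ∀ s ∈ S, ∃ t ≠ m, s * e t = s) :
    cornerDim k (↥(ProjMod e m) ⧸ S • (⊤ : Submodule A ↥(ProjMod e m))) (e l) =
      cornerDim k (↥(offDiagPart e m) ⧸ S • (⊤ : Submodule A ↥(offDiagPart e m))) (e l) := by
  have hproj := cornerDim_add k (hidem l) (S • (⊤ : Submodule A ↥(ProjMod e m)))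
  have hoff := cornerDim_add k (hidem l) (S • (⊤ : Submodule A ↥(offDiagPart e m)))
  have heq : cornerDim k ↥(offDiagPart e m) (e l) = cornerDim k ↥(ProjMod e m) (e l) := by
    rw [← cornerDim_top_submodule k _ (M := ↥(ProjMod e m)), cornerDim_eq_iff_of_le le_top]
    intro x _ hx
    rw [← hx]
    exact mem_set_smul_of_mem_mem (Set.mem_image_of_mem e hml.symm) mem_top
  rw [cornerDim_congr k (setSMulTopEquiv S _), ← set_smul_top_eq_set_smul_offDiagPart hS] at hoff
  omega

variable [IsAlgClosed k]

theorem cornerDim_quotient_eq_mul_projMod (hprim : ∀ l, IsPrimitiveIdempotent (e l))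
    (hnr : NoReturn e) {l : Λ} {T : Set Λ} (hl : l ∉ T) :
    cornerDim k (↥(ProjMod e l) ⧸ (e '' T) • (⊤ : Submodule A ↥(ProjMod e l))) (e l) =
      cornerDim k ↥(ProjMod e l) (e l) * cornerDim k (↥(ProjMod e l) ⧸
        (e '' T ∪ nilCorner (e l)) • (⊤ : Submodule A ↥(ProjMod e l))) (e l) := by
  have := IsArtinianRing.of_finite k A
  have hone := (cornerDim_quotient_eq_one_iff k (hprim l)
    (K := (e '' T ∪ nilCorner (e l)) • ⊤)).2 ⟨(sup_set_smul _ _ _).trans_le (sup_le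
      (le_jacobson_of_ne_top (hprim l) (hnr.set_smul_top_ne_top hprim hl))
      (nilCorner_smul_top_le_jacobson (hprim l))), set_smul_mono_left ⊤ Set.subset_union_right⟩
  rw [hnr.cornerDim_quotient_set_smul_top k (fun m => (hprim m).1) hl, hone, mul_one]

/-- Every copy of the simple top of `P_l` in the largest quotient of `M` killed by `e '' T` comes
from the endomorphisms of `P_l`. -/
theorem cornerDim_quotient_eq_mul [Fintype Λ] (he : CompleteOrthogonalIdempotents e)
    (hprim : ∀ l, IsPrimitiveIdempotent (e l)) (hnr : NoReturn e)
    (hJ : ∀ l, Module.Projective A ↥(offDiagPart e l)) {l : Λ} {T : Set Λ} (hl : l ∉ T)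
    (M : Type u) [AddCommGroup M] [Module A M] [Module k M] [IsScalarTower k A M]
    [FiniteDimensional k M] [Module.Projective A M] :
    cornerDim k (M ⧸ (e '' T) • (⊤ : Submodule A M)) (e l) =
      cornerDim k ↥(ProjMod e l) (e l) *
        cornerDim k (M ⧸ (e '' T ∪ nilCorner (e l)) • (⊤ : Submodule A M)) (e l) := by
  have hidem (m) := (hprim m).1
  refine projective_induction k he hprim hnr hJ (fun M =>
    cornerDim k (M ⧸ (e '' T) • (⊤ : Submodule A M)) (e l) =
      cornerDim k ↥(ProjMod e l) (e l) *
        cornerDim k (M ⧸ (e '' T ∪ nilCorner (e l)) • (⊤ : Submodule A M)) (e l)) ?_ ?_ ?_ M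
  · intro M _ _ _ _ _ _
    have hzero (N : Submodule A M) : cornerDim k (M ⧸ N) (e l) = 0 :=
      (cornerDim_eq_zero_iff (hidem l)).2 fun x => Subsingleton.elim _ _
    rw [hzero, hzero, mul_zero]
  · intro M _ _ _ _ _ m φ σ hσ hker hproj
    rw [cornerDim_quotient_set_smul_split k (hidem l) _ hσ, hker, hproj,
      cornerDim_quotient_set_smul_split k (hidem l) _ hσ, mul_add]
  · intro m hm
    by_cases hmT : m ∈ T
    · have hzero (S : Set A) (hS : e m ∈ S) :
          cornerDim k (↥(ProjMod e m) ⧸ S • (⊤ : Submodule A ↥(ProjMod e m))) (e l) = 0 := by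
        rw [set_smul_top_span_of_mem (hidem m) hS, cornerDim_quotient_eq_zero_iff (hidem l)]
        exact fun _ => mem_top
      have hmem := Set.mem_image_of_mem e hmT
      rw [hzero _ hmem, hzero _ (.inl hmem), mul_zero]
    obtain rfl | hml := eq_or_ne m l
    · exact cornerDim_quotient_eq_mul_projMod k hprim hnr hl
    · have hT : ∀ s ∈ e '' T, ∃ t ≠ m, s * e t = s := Set.forall_mem_image.2 fun t ht =>
        ⟨t, ne_of_mem_of_not_mem ht hmT, hidem t⟩
      have hN : ∀ s ∈ nilCorner (e l), ∃ t ≠ m, s * e t = s := fun s hs => ⟨l, hml.symm, hs.2.1⟩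
      rw [cornerDim_quotient_set_smul_offDiagPart k hidem hml hT, hm,
        cornerDim_quotient_set_smul_offDiagPart k hidem hml
          fun s hs => hs.elim (hT s) (hN s)]

end DimensionCount

section Opposite

variable {A : Type*} [Ring A] {Λ : Type*} {e : Λ → A} {f : A}

theorem IsPrimitiveIdempotent.op (hf : IsPrimitiveIdempotent f) :
    IsPrimitiveIdempotent (op f) := by
  refine ⟨congrArg MulOpposite.op hf.1.eq, (op_ne_zero_iff f).2 hf.2.1,
    fun g h hg hh hgh hhg hsum => ?_⟩
  exact (hf.2.2 (unop g) (unop h) (congrArg unop hg.eq) (congrArg unop hh.eq)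
    (congrArg unop hhg) (congrArg unop hgh) (congrArg unop hsum)).imp
      (unop_eq_zero_iff g).1 (unop_eq_zero_iff h).1

theorem completeOrthogonalIdempotents_op [Fintype Λ] (he : CompleteOrthogonalIdempotents e) :
    CompleteOrthogonalIdempotents fun l => op (e l) where
  idem l := congrArg op (he.idem l).eq
  ortho _ _ h := congrArg op (he.ortho h.symm)
  complete := by rw [← Finset.op_sum, he.complete, op_one]

theorem nilCorner_op (f : A) : nilCorner (op f) = op '' nilCorner f := by
  ext x
  constructor
  · rintro ⟨hfx, hxf, n, hn⟩
    exact ⟨unop x, ⟨congrArg unop hxf, congrArg unop hfx, n, congrArg unop hn⟩, rfl⟩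
  · rintro ⟨x, ⟨hfx, hxf, n, hn⟩, rfl⟩
    exact ⟨congrArg op hxf, congrArg op hfx, n, congrArg op hn⟩

theorem op_mem_set_smul_top_iff (hf : IsIdempotentElem f) {S : Set A} {p : ↥(span A {f})} :
    op (p : A) ∈ (op '' S) • (⊤ : Submodule Aᵐᵒᵖ Aᵐᵒᵖ) ↔
      p ∈ S • (⊤ : Submodule A ↥(span A {f})) := by
  let toSpan : Aᵐᵒᵖ →+ ↥(span A {f}) :=
    (LinearMap.toSpanSingleton A _ (gen f)).toAddMonoidHom.comp opAddEquiv.symm.toAddMonoidHom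
  let toOp : ↥(span A {f}) →+ Aᵐᵒᵖ :=
    opAddEquiv.toAddMonoidHom.comp (span A {f}).subtype.toAddMonoidHom
  constructor <;> intro h
  · have hmem : (1 : Aᵐᵒᵖ) • op (p : A) ∈
        (S • (⊤ : Submodule A ↥(span A {f}))).toAddSubgroup.comap toSpan := by
      refine smul_mem_of_mem_set_smul ?_ h
      rintro a _ ⟨s, hs, rfl⟩ n -
      change (unop n * s * unop a * 1) • gen f ∈ S • (⊤ : Submodule A ↥(span A {f}))
      rw [mul_one, mul_assoc, mul_smul, mul_smul]
      exact smul_mem _ _ (mem_set_smul_of_mem_mem hs mem_top)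
    rw [one_smul] at hmem
    rw [← smul_gen hf p]
    exact hmem
  · have hmem : (1 : A) • p ∈
        ((op '' S) • (⊤ : Submodule Aᵐᵒᵖ Aᵐᵒᵖ)).toAddSubgroup.comap toOp := by
      refine smul_mem_of_mem_set_smul ?_ h
      rintro a s hs n -
      change op (n : A) * op s * op a * op 1 ∈ (op '' S) • (⊤ : Submodule Aᵐᵒᵖ Aᵐᵒᵖ)
      rw [mul_assoc, mul_assoc]
      exact smul_mem _ _ (mem_set_smul_of_mem_mem (Set.mem_image_of_mem op hs) mem_top)
    rwa [one_smul] at hmem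

variable (k : Type*) [Field k] [Algebra k A]

theorem cornerDim_op_quotient (hf : IsIdempotentElem f) (S : Set A) :
    cornerDim k (Aᵐᵒᵖ ⧸ (op '' S) • (⊤ : Submodule Aᵐᵒᵖ Aᵐᵒᵖ)) (op f) =
      Module.finrank k (↥(span A {f}) ⧸ S • (⊤ : Submodule A ↥(span A {f}))) := by
  set G := (op '' S) • (⊤ : Submodule Aᵐᵒᵖ Aᵐᵒᵖ)
  set K := S • (⊤ : Submodule A ↥(span A {f}))
  let θ : ↥(span A {f}) →ₗ[k] Aᵐᵒᵖ ⧸ G :=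
    (G.mkQ.restrictScalars k) ∘ₗ (opLinearEquiv k : A ≃ₗ[k] Aᵐᵒᵖ).toLinearMap ∘ₗ
      ((span A {f}).subtype.restrictScalars k)
  have hrange : LinearMap.range θ = fixedBy k (Aᵐᵒᵖ ⧸ G) (op f) := by
    ext x
    constructor
    · rintro ⟨p, rfl⟩
      exact congrArg (fun a => G.mkQ (op a)) ((mem_span_idem hf).1 p.2)
    · intro hx
      obtain ⟨b, rfl⟩ := G.mkQ_surjective x
      exact ⟨unop b • gen f, hx⟩
  have hker : LinearMap.ker θ = K.restrictScalars k := by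
    ext p
    exact (Quotient.mk_eq_zero G).trans (op_mem_set_smul_top_iff hf)
  rw [cornerDim, ← hrange, ← θ.quotKerEquivRange.finrank_eq, hker]
  rfl

theorem cornerDim_span_op (hf : IsIdempotentElem f) :
    cornerDim k ↥(span Aᵐᵒᵖ {op f}) (op f) = cornerDim k ↥(span A {f}) f := by
  have hf' : IsIdempotentElem (op f) := congrArg op hf.eq
  rw [cornerDim_submodule, cornerDim_submodule]
  refine ((opLinearEquiv k : A ≃ₗ[k] Aᵐᵒᵖ).ofSubmodules
    (fixedBy k A f ⊓ (span A {f}).restrictScalars k) _ ?_).finrank_eq.symm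
  ext x
  rw [mem_map_equiv, mem_inf, mem_inf, restrictScalars_mem, restrictScalars_mem, mem_span_idem hf,
    mem_span_idem hf', mem_fixedBy, mem_fixedBy, and_comm, ← unop_inj, ← unop_inj (x := x * op f)]
  rfl

end Opposite

section ProperFiltration

variable {A M : Type*} [Ring A] [AddCommGroup M] [Module A M] {f : A}

theorem exists_nilCorner_smul_eq_zero [IsArtinianRing A] [IsArtinian A M]
    (hf : IsPrimitiveIdempotent f) (h : ∃ y : M, f • y ≠ 0) :
    ∃ x : M, x ≠ 0 ∧ f • x = x ∧ ∀ s ∈ nilCorner f, s • x = 0 := by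
  obtain ⟨y, hy⟩ := h
  obtain ⟨N, ⟨x, hx0, hfx, rfl⟩, hmin⟩ := IsArtinian.set_has_minimal
    {N : Submodule A M | ∃ x, x ≠ 0 ∧ f • x = x ∧ span A {x} = N}
    ⟨_, f • y, hy, by rw [← mul_smul, hf.1.eq], rfl⟩
  refine ⟨x, hx0, hfx, fun s hs => by_contra fun hsx => ?_⟩
  have hle : span A {s • x} ≤ span A {x} :=
    (span_singleton_le_iff_mem _ _).2 (smul_mem _ _ (mem_span_singleton_self x))
  have hfsx : f • s • x = s • x := by rw [← mul_smul, hs.1]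
  have hmem : x ∈ span A {s • x} :=
    (hle.eq_of_not_lt (hmin _ ⟨s • x, hsx, hfsx, rfl⟩)) ▸ mem_span_singleton_self x
  obtain ⟨a, ha⟩ := mem_span_singleton.1 hmem
  -- `f a s` lies in the radical of the local ring `f A f`, yet it fixes `x`.
  let p : ↥(span A {f}) := ⟨f * a * s, (mem_span_idem hf.1).2 (by rw [mul_assoc, hs.2.1])⟩
  have hpf : f * (p : A) = p := by rw [← mul_assoc, ← mul_assoc, hf.1.eq]
  have hp : p ∈ Module.jacobson A ↥(span A {f}) :=
    smul_mem _ (f * a) (x := ⟨s, (mem_span_idem hf.1).2 hs.2.1⟩)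
      ((mem_jacobson_iff_isNilpotent hf hs.1).2 hs.2.2)
  have hpx : (p : A) • x = x := by rw [mul_smul, mul_smul, ha, hfx]
  obtain ⟨n, hn⟩ := (mem_jacobson_iff_isNilpotent hf hpf).1 hp
  have hpow (m : ℕ) : (p : A) ^ m • x = x := by
    induction m with
    | zero => rw [pow_zero, one_smul]
    | succ m ih => rw [pow_succ, mul_smul, hpx, ih]
  exact hx0 (by rw [← hpow n, hn, zero_smul])

variable (k : Type*) [Field k] [Algebra k A] [FiniteDimensional k A] [IsAlgClosed k]
  [Module k M] [IsScalarTower k A M] [FiniteDimensional k M]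

theorem exists_surjective_cornerDim_eq_one (hf : IsPrimitiveIdempotent f) {S : Set A}
    (hS : ∀ s ∈ S, ∀ y : M, s • y = 0) (h : ∃ y : M, f • y ≠ 0) :
    ∃ (Z : Submodule A M)
      (g : ↥(span A {f}) ⧸ (S ∪ nilCorner f) • (⊤ : Submodule A ↥(span A {f})) →ₗ[A] ↥Z),
      Function.Surjective g ∧ cornerDim k ↥Z f = 1 := by
  have := IsArtinianRing.of_finite k A
  have := Module.Finite.of_restrictScalars_finite k A M
  obtain ⟨x, hx0, hfx, hx⟩ := exists_nilCorner_smul_eq_zero hf h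
  have hnil : nilCorner f • ⊤ ≤ LinearMap.ker (evalAt f x) := by
    refine set_smul_le _ _ _ fun s p hs _ => ?_
    have hfsp : f * (s • p : ↥(span A {f})) = (s • p : ↥(span A {f})) :=
      (mul_assoc f s _).symm.trans (congrArg (· * (p : A)) hs.1)
    have hjac : s • p ∈ Module.jacobson A ↥(span A {f}) :=
      nilCorner_smul_top_le_jacobson hf (mem_set_smul_of_mem_mem hs mem_top)
    exact hx _ ⟨hfsp, (mem_span_idem hf.1).1 (s • p).2,
      (mem_jacobson_iff_isNilpotent hf hfsp).1 hjac⟩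
  have hker : (S ∪ nilCorner f) • ⊤ ≤ LinearMap.ker (evalAt f x).rangeRestrict := by
    rw [LinearMap.ker_rangeRestrict]
    refine (sup_set_smul _ _ _).trans_le (sup_le (set_smul_le _ _ _ fun s p hs _ => ?_) hnil)
    exact (map_smul (evalAt f x) s p).trans (hS s hs _)
  have hne : LinearMap.ker (evalAt f x) ≠ ⊤ := fun htop =>
    evalAt_ne_zero (hfx.trans_ne hx0) (LinearMap.ker_eq_top.1 htop)
  refine ⟨LinearMap.range (evalAt f x), liftQ _ _ hker, ?_, ?_⟩
  · exact fun z => (LinearMap.surjective_rangeRestrict _ z).elim fun p hp => ⟨mkQ _ p, hp⟩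
  · rw [← cornerDim_congr k (evalAt f x).quotKerEquivRange, cornerDim_quotient_eq_one_iff k hf]
    exact ⟨le_jacobson_of_ne_top hf hne, hnil⟩

theorem finrank_le_and_hasFiltrationBy (hf : IsPrimitiveIdempotent f) {S : Set A}
    (hS : ∀ s ∈ S, ∀ y : M, s • y = 0) (htop : ({f} : Set A) • (⊤ : Submodule A M) = ⊤) :
    Module.finrank k M ≤ cornerDim k M f * Module.finrank k
        (↥(span A {f}) ⧸ (S ∪ nilCorner f) • (⊤ : Submodule A ↥(span A {f}))) ∧
      (Module.finrank k M = cornerDim k M f * Module.finrank k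
        (↥(span A {f}) ⧸ (S ∪ nilCorner f) • (⊤ : Submodule A ↥(span A {f}))) →
        HasFiltrationBy A M fun _ : Unit =>
          ↥(span A {f}) ⧸ (S ∪ nilCorner f) • (⊤ : Submodule A ↥(span A {f}))) := by
  induction hn : cornerDim k M f generalizing M with
  | zero =>
    have hzero := (cornerDim_eq_zero_iff hf.1).1 hn
    have : Subsingleton M := by
      refine subsingleton_iff A |>.1 (subsingleton_of_bot_eq_top (htop ▸ le_antisymm bot_le ?_))
      exact set_smul_le _ _ _ (by rintro _ y rfl -; exact hzero y)
    rw [zero_mul, Module.finrank_zero_of_subsingleton]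
    exact ⟨le_rfl, fun _ => hasFiltrationBy_of_subsingleton⟩
  | succ n ih =>
    have hne : ∃ y : M, f • y ≠ 0 := by
      by_contra! h
      have := (cornerDim_eq_zero_iff hf.1 (k := k)).2 h
      omega
    obtain ⟨Z, g, hg, hZ⟩ := exists_surjective_cornerDim_eq_one k hf hS hne
    have hquot : cornerDim k (M ⧸ Z) f = n := by
      have := cornerDim_add k hf.1 Z
      omega
    obtain ⟨hle, hfilt⟩ := ih (M := M ⧸ Z)
      (fun s hs => Z.mkQ_surjective.forall.2 fun y => by rw [← map_smul, hS s hs, map_zero])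
      (by rw [← range_mkQ, ← Submodule.map_top, ← map_set_smul, htop]) hquot
    have hgle : Module.finrank k ↥Z ≤ Module.finrank k
        (↥(span A {f}) ⧸ (S ∪ nilCorner f) • (⊤ : Submodule A ↥(span A {f}))) :=
      LinearMap.finrank_le_finrank_of_surjective (f := g.restrictScalars k) hg
    have hadd := finrank_quotient_add k Z
    rw [add_one_mul]
    refine ⟨by omega, fun heq => hasFiltrationBy_of_quotient Z ?_ (hfilt (by omega))⟩
    have hginj : Function.Injective g :=
      (LinearMap.injective_iff_surjective_of_finrank_eq_finrank (f := g.restrictScalars k)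
        (by omega)).2 hg
    exact hasFiltrationBy_of_equiv () (LinearEquiv.ofBijective g ⟨hginj, hg⟩).symm

end ProperFiltration

section ProperStandardFiltration

variable (k : Type*) [Field k] [IsAlgClosed k] {A : Type u} [Ring A] [Algebra k A]
  [FiniteDimensional k A] {Λ : Type*} {e : Λ → A}

theorem finrank_quotient_eq_cornerDim_mul [Fintype Λ] (he : CompleteOrthogonalIdempotents e)
    (hprim : ∀ l, IsPrimitiveIdempotent (e l)) (hnr : NoReturn e)
    (hJop : ∀ l, Module.Projective Aᵐᵒᵖ ↥(offDiagPart (fun m => op (e m)) l)) {l : Λ} {T : Set Λ}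
    (hl : l ∉ T) :
    Module.finrank k (↥(ProjMod e l) ⧸ (e '' T) • (⊤ : Submodule A ↥(ProjMod e l))) =
      cornerDim k ↥(ProjMod e l) (e l) * Module.finrank k (↥(ProjMod e l) ⧸
        (e '' T ∪ nilCorner (e l)) • (⊤ : Submodule A ↥(ProjMod e l))) := by
  have hcount := cornerDim_quotient_eq_mul k (completeOrthogonalIdempotents_op he)
    (fun m => (hprim m).op) hnr.op hJop hl Aᵐᵒᵖ
  rwa [← Set.image_image op e T, nilCorner_op, ← Set.image_union,
    cornerDim_op_quotient k (hprim l).1, cornerDim_op_quotient k (hprim l).1,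
    cornerDim_span_op k (hprim l).1] at hcount

include k in
theorem hasFiltrationBy_properStandardMod [Fintype Λ] [LinearOrder Λ]
    (he : CompleteOrthogonalIdempotents e) (hprim : ∀ l, IsPrimitiveIdempotent (e l))
    (hbasic : IsBasic e) (hnr : NoReturn e)
    (hJ : ∀ l, Module.Projective A ↥(offDiagPart e l))
    (hJop : ∀ l, Module.Projective Aᵐᵒᵖ ↥(offDiagPart (fun m => op (e m)) l)) :
    HasFiltrationBy A A (ProperStandardMod e) := by
  refine (hasFiltrationBy_standardMod k he hprim hnr hJ).refine fun l => ?_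
  have hl : l ∉ Set.Ioi l := by simp
  set K := (e '' Set.Ioi l) • (⊤ : Submodule A ↥(ProjMod e l))
  have hkill : ∀ s ∈ e '' Set.Ioi l, ∀ y : ↥(ProjMod e l) ⧸ K, s • y = 0 := fun s hs =>
    K.mkQ_surjective.forall.2 fun p =>
      (Quotient.mk_eq_zero K).2 (mem_set_smul_of_mem_mem hs mem_top)
  have hgen : ({e l} : Set A) • (⊤ : Submodule A (↥(ProjMod e l) ⧸ K)) = ⊤ := by
    rw [← range_mkQ, ← Submodule.map_top, ← map_set_smul,
      set_smul_top_span_of_mem (hprim l).1 (Set.mem_singleton _)]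
  have hcount := finrank_quotient_eq_cornerDim_mul k he hprim hnr hJop hl
  rw [← hnr.cornerDim_quotient_set_smul_top k (fun m => (hprim m).1) hl] at hcount
  have hfilt := (finrank_le_and_hasFiltrationBy k (hprim l) hkill hgen).2 hcount
  exact (hfilt.refine fun _ => hasFiltrationBy_of_equiv l
    (quotEquivOfEq _ _ (properStandardKer_eq k hprim hbasic l).symm)).congr
    (quotEquivOfEq _ _ (standardKer_eq k hprim l).symm)

end ProperStandardFiltration

section Main

variable {k : Type*} [Field k] {A : Type*} [Ring A] [Algebra k A] {Λ : Type*} [Fintype Λ]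
  {e : Λ → A} {he : CompleteOrthogonalIdempotents e}

theorem projective_leftJ_iff (hnr : NoReturn e) (hd : IsDirectedCategory (AssocCat k he)) :
    Module.Projective A ↥(leftJ hd) ↔ ∀ l, Module.Projective A ↥(offDiagPart e l) :=
  projective_iff_forall_offDiagPart he hnr fun _ => mem_offDiag_iff k he

theorem projective_rightJ_iff (hnr : NoReturn e) (hd : IsDirectedCategory (AssocCat k he)) :
    Module.Projective Aᵐᵒᵖ ↥(rightJ hd) ↔
      ∀ l, Module.Projective Aᵐᵒᵖ ↥(offDiagPart (fun m => op (e m)) l) := by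
  let ω : A ≃ₗ[Aᵐᵒᵖ] Aᵐᵒᵖ := { opAddEquiv with map_smul' := fun _ _ => rfl }
  rw [← projective_iff_forall_offDiagPart (completeOrthogonalIdempotents_op he) hnr.op
    (J := (rightJ hd).map ω.toLinearMap) fun x => ?_]
  · exact ⟨fun _ => .of_equiv (ω.submoduleMap _), fun _ => .of_equiv (ω.submoduleMap _).symm⟩
  · rw [mem_map_equiv]
    refine (mem_offDiag_iff k he).trans (forall_congr' fun l => ?_)
    rw [← op_inj, mul_assoc]
    rfl

end Main

end StratAlg

theorem corollary1p9 {k : Type*} [Field k] [IsAlgClosed k]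
    {A : Type*} [Ring A] [Algebra k A] [FiniteDimensional k A]
    {Λ : Type*} [Fintype Λ] (e : Λ → A) (he : CompleteOrthogonalIdempotents e)
    (hprim : ∀ l, StratAlg.IsPrimitiveIdempotent (e l)) (hbasic : StratAlg.IsBasic e) :
    (∀ _ : LinearOrder Λ, StratAlg.IsProperlyStratified e) ↔
      ∃ hd : StratAlg.IsDirectedCategory (StratAlg.AssocCat k he),
        Module.Projective A ↥(StratAlg.leftJ hd) ∧
          Module.Projective Aᵐᵒᵖ ↥(StratAlg.rightJ hd) := by
  have hidem (l) := (hprim l).1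
  constructor
  · intro H
    obtain ⟨r, hr, hre⟩ :=
      StratAlg.isDirectedBy_of_hasFiltrationBy k hprim hbasic fun L => (H L).1
    have hd := (StratAlg.isDirectedCategory_iff k he).2 ⟨r, hr, hre⟩
    exact ⟨hd, (StratAlg.projective_leftJ_iff (hre.noReturn hidem) hd).2
      (StratAlg.projective_offDiagPart k hprim hre fun L => (H L).1),
      StratAlg.projective_rightJ k hre hprim hbasic (fun L => (H L).2) hd⟩
  · rintro ⟨hd, hleft, hright⟩ L
    obtain ⟨r, hr, hre⟩ := (StratAlg.isDirectedCategory_iff k he).1 hd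
    have hnr := hre.noReturn hidem
    have hJ := (StratAlg.projective_leftJ_iff hnr hd).1 hleft
    have hJop := (StratAlg.projective_rightJ_iff hnr hd).1 hright
    exact ⟨StratAlg.hasFiltrationBy_standardMod k he hprim hnr hJ,
      StratAlg.hasFiltrationBy_properStandardMod k he hprim hbasic hnr hJ hJop⟩
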